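/- Let $E_{jk}$ be the $4\times4$ matrix units and write $\langle\cdot\rangle$ for complex span. A grading of a Lie algebra $L$ is a decomposition $L=\bigoplus_{k}L_k$ into nonzero subspaces such that each $[L_k,L_l]$ lies in some $L_m$. It is a group grading if its index set can be chosen as a subset of a group (an Abelian one) such that $[L_k,L_l]\ne0$ implies $[L_k,L_l]\subseteq L_{k\star l}$. It is a fine group grading if it is a group grading and has no refinement other than itself that is a group grading. A real form of a complex Lie algebra $L$ is a real Lie subalgebra $P$ such that each $x\in L$ is uniquely $u+iv$ with $u,v\in P$. Consider the following decompositions of $sl(4,\mathbb C)$, with $L_1,L_2,\dots$ listed in order: - $\Gamma_3$: $\langle E_{14}\pm E_{41}\rangle$, $\langle E_{24}\pm E_{42}\rangle$, $\langle E_{34}\pm E_{43}\rangle$, $\langle E_{13}\pm E_{31}\rangle$, $\langle E_{23}\pm E_{32}\rangle$, $\langle E_{12}\pm E_{21}\rangle$ ($+$ before $-$ in each pair), $\langle E_{11}-E_{22},E_{22}-E_{33},E_{33}-E_{44}\rangle$. - $\Gamma_4$: $\langle E_{13}\mp E_{41}\rangle$, $\langle E_{14}\mp E_{31}\rangle$,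 $\langle E_{24}\mp E_{32}\rangle$, $\langle E_{23}\mp E_{42}\rangle$, $\langle E_{12}\mp E_{21}\rangle$ ($-$ before $+$), $\langle E_{34}\rangle$, $\langle E_{43}\rangle$, $\langle E_{33}-E_{44}\rangle$, $\langle E_{11}-E_{22},E_{11}+E_{22}-E_{33}-E_{44}\rangle$. - $\Gamma_5$: $\langle E_{23}\mp E_{41}\rangle$, $\langle E_{24}\mp E_{31}\rangle$, $\langle E_{13}\mp E_{42}\rangle$, $\langle E_{14}\mp E_{32}\rangle$ ($-$ before $+$), $\langle E_{12}\rangle$, $\langle E_{21}\rangle$, $\langle E_{34}\rangle$, $\langle E_{43}\rangle$, $\langle E_{11}+E_{22}-E_{33}-E_{44}\rangle$, $\langle E_{11}-E_{22}+E_{33}-E_{44},E_{11}-E_{22}-E_{33}+E_{44}\rangle$. - $\Gamma_6$: the lines spanned by $E_{11}-E_{22}+E_{33}-E_{44}$, $E_{11}-E_{22}-E_{33}+E_{44}$, $E_{11}+E_{22}-E_{33}-E_{44}$, $E_{13}-E_{24}+E_{31}-E_{42}$, $E_{13}+E_{24}-E_{31}-E_{42}$, $E_{13}+E_{24}+E_{31}+E_{42}$,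 $E_{13}-E_{24}-E_{31}+E_{42}$, $E_{21}+E_{43}$, $E_{21}-E_{43}$, $E_{14}-E_{32}$, $E_{14}+E_{32}$, $E_{23}-E_{41}$, $E_{23}+E_{41}$, $E_{12}+E_{34}$, $E_{12}-E_{34}$. - $\Gamma_7$: the lines spanned by $E_{14}+E_{23}+E_{32}+E_{41}$, $E_{14}-E_{23}-E_{32}+E_{41}$, $E_{14}-E_{23}+E_{32}-E_{41}$, $E_{14}+E_{23}-E_{32}-E_{41}$, $E_{13}+E_{24}+E_{31}+E_{42}$, $E_{13}-E_{24}-E_{31}+E_{42}$, $E_{13}-E_{24}+E_{31}-E_{42}$, $E_{13}+E_{24}-E_{31}-E_{42}$, $E_{12}+E_{21}+E_{34}+E_{43}$, $E_{12}-E_{21}-E_{34}+E_{43}$, $E_{12}-E_{21}+E_{34}-E_{43}$, $E_{12}+E_{21}-E_{34}-E_{43}$, $E_{11}-E_{22}-E_{33}+E_{44}$, $E_{11}-E_{22}+E_{33}-E_{44}$, $E_{11}+E_{22}-E_{33}-E_{44}$. - $\Gamma_8$: the lines spanned by $E_{13}+E_{24}+E_{32}+E_{41}$, $E_{13}-E_{24}-E_{32}+E_{41}$,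 $E_{13}-E_{24}+E_{32}-E_{41}$, $E_{13}+E_{24}-E_{32}-E_{41}$, $E_{14}+E_{23}+E_{31}+E_{42}$, $E_{14}-E_{23}-E_{31}+E_{42}$, $E_{14}-E_{23}+E_{31}-E_{42}$, $E_{14}+E_{23}-E_{31}-E_{42}$, $E_{11}+E_{22}-E_{33}-E_{44}$, $E_{11}-E_{22}$, $E_{33}-E_{44}$, $E_{12}-E_{21}$, $E_{34}-E_{43}$, and then the plane $\langle E_{12}+E_{21},E_{34}+E_{43}\rangle$. For symmetric invertible $K$ let $o_K(4,\mathbb C)=\{X\in\mathbb C^{4\times4}: XK=-KX^T\}$. For $F\overline F=-I$ let $su^*_F(4)=\{X\in sl(4,\mathbb C): XF=F\overline X\}$, and for hermitian $E$ with $p$ positive and $q=4-p$ negative eigenvalues let $su_E(p,q)=\{X\in sl(4,\mathbb C): XE=-EX^+\}$. With $\sigma=\left(\begin{smallmatrix}0&1\\1&0\end{smallmatrix}\right)$, $\epsilon=\left(\begin{smallmatrix}0&1\\-1&0\end{smallmatrix}\right)$ and block sums $\oplus$, put $K_1=I$, $K_2=I_2\oplus\sigma$, $K_3=\sigma\oplus\sigma$;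 $F_1=\left(\begin{smallmatrix}0&I_2\\-I_2&0\end{smallmatrix}\right)$, $F_2=\epsilon\oplus i\epsilon$; $E^{(4,0)}_1=I$; $E^{(3,1)}_1=\mathrm{diag}(1,1,1,-1)$, $E^{(3,1)}_2=I_2\oplus\sigma$; $E^{(2,2)}_1=\mathrm{diag}(1,1,-1,-1)$, $E^{(2,2)}_2=\mathrm{diag}(1,-1)\oplus\sigma$, $E^{(2,2)}_3=\sigma\oplus\sigma$, $E^{(2,2)}_5=\mathrm{diag}(1,-1)\oplus i\epsilon$. The matrices $F_1,F_2$ satisfy $F\overline F=-I$, and each $E^{(p,q)}_j$ is hermitian with $p$ positive and $q$ negative eigenvalues. In each of the following 14 cases, $\Gamma_j:sl(4,\mathbb C)=\bigoplus_k L_k$ is a fine group grading; the given algebra $P$ ($su^*_F(4)$ or $su_E(p,q)$) is a real form of $sl(4,\mathbb C)$; each $L_k$ is the complex span of $L_k\cap P$, and $\Gamma_j^{\mathcal J}:P=\bigoplus_k (L_k\cap P)$ is a fine group grading of $P$. The algebra $o_K(4,\mathbb C)\cap P$ is a real form of $o_K(4,\mathbb C)$, isomorphic to the stated real Lie algebra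 $so^*(4)=\{X\in\mathbb C^{4\times4}: X^T=-X,\ X^+F_1+F_1X=0\}$ or $so(p,q)$. Moreover $o_K(4,\mathbb C)=\bigoplus_{k\in S_j}L_k$ and $o_K(4,\mathbb C)\cap P=\bigoplus_{k\in S_j}(L_k\cap P)$, and the latter is a fine group grading of $o_K(4,\mathbb C)\cap P$ (displayed by $\Gamma_j^{\mathcal J}$). Here $S_3=\{2,4,6,8,10,12\}$, $S_4=\{1,3,5,7,9,13\}$, $S_5=\{1,3,5,7,14\}$, $S_6=\{1,2,4,5,10,12\}$, $S_7=\{3,4,6,8,10,11\}$, $S_8=\{3,4,6,8,11,12\}$. - $so^*(4)$: $\Gamma_6$ with $(K_3,\,su^*_{F_1}(4))$; $\Gamma_7$ with $(K_1,\,su^*_{F_1}(4))$; $\Gamma_8$ with $(K_2,\,su^*_{F_2}(4))$. - $so(4,0)$: $\Gamma_3$ and $\Gamma_7$ with $(K_1,\,su_{E^{(4,0)}_1}(4,0))$. - $so(3,1)$: $\Gamma_3$ with $(K_1,\,su_{E^{(3,1)}_1}(3,1))$; $\Gamma_4$ and $\Gamma_8$ with $(K_2,\,su_{E^{(3,1)}_2}(3,1))$.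 - $so(2,2)$: $\Gamma_3$ and $\Gamma_7$ with $(K_1,\,su_{E^{(2,2)}_1}(2,2))$; $\Gamma_4$ with $(K_2,\,su_{E^{(2,2)}_2}(2,2))$; $\Gamma_5$ and $\Gamma_6$ with $(K_3,\,su_{E^{(2,2)}_3}(2,2))$; $\Gamma_8$ with $(K_2,\,su_{E^{(2,2)}_5}(2,2))$. -/

import Mathlib

open Matrix

attribute [local instance 100] LieRing.ofAssociativeRing

noncomputable section

namespace FineGradings

/-! ### Gradings of Lie algebras

The Lie algebra that is graded is a Lie subalgebra `H` of an ambient Lie algebra `A`; its grading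
subspaces are given as subspaces of `A`. -/

section Gradings

variable {𝕜 A : Type} [Field 𝕜] [LieRing A] [LieAlgebra 𝕜 A]

/-- `H` is the direct sum of the nonzero subspaces `Γ k`, and every `[Γ k, Γ l]` is contained in
some `Γ m`. -/
structure IsGrading (H : LieSubalgebra 𝕜 A) {ι : Type} (Γ : ι → Submodule 𝕜 A) : Prop where
  ne_bot : ∀ k, Γ k ≠ ⊥
  independent : iSupIndep Γ
  iSup_eq : ⨆ k, Γ k = H.toSubmodule
  bracket : ∀ k l, ∃ m, ∀ x ∈ Γ k, ∀ y ∈ Γ l, ⁅x, y⁆ ∈ Γ m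

/-- `d` labels the grading subspaces by pairwise different elements of the group `G` such that
`0 ≠ [Γ k, Γ l]` implies `[Γ k, Γ l] ⊆ Γ m` for the index `m` with label `d k * d l`. -/
def IsGroupLabelling {ι : Type} (Γ : ι → Submodule 𝕜 A) {G : Type} [Group G] (d : ι → G) : Prop :=
  Function.Injective d ∧
    ∀ k l, (∃ x ∈ Γ k, ∃ y ∈ Γ l, ⁅x, y⁆ ≠ 0) →
      ∃ m, d m = d k * d l ∧ ∀ x ∈ Γ k, ∀ y ∈ Γ l, ⁅x, y⁆ ∈ Γ m

/-- A group grading: a grading whose index set can be chosen as a subset of a group. -/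
def IsGroupGrading (H : LieSubalgebra 𝕜 A) {ι : Type} (Γ : ι → Submodule 𝕜 A) : Prop :=
  IsGrading H Γ ∧ ∃ (G : Type) (_ : Group G) (d : ι → G), IsGroupLabelling Γ d

/-- A group grading whose index set can be chosen as a subset of an Abelian group. -/
def IsAbelianGroupGrading (H : LieSubalgebra 𝕜 A) {ι : Type} (Γ : ι → Submodule 𝕜 A) : Prop :=
  IsGrading H Γ ∧ ∃ (G : Type) (_ : CommGroup G) (d : ι → G), IsGroupLabelling Γ d

/-- `Γ'` is a refinement of `Γ`: every `Γ k` is the sum of those `Γ' i` that are assigned to it. -/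
def IsRefinement {ι ι' : Type} (Γ : ι → Submodule 𝕜 A) (Γ' : ι' → Submodule 𝕜 A) : Prop :=
  ∃ f : ι' → ι, ∀ k, Γ k = ⨆ i : {i // f i = k}, Γ' i

/-- A fine group grading: a group grading that has no group refinement but itself. The labels of
`Γ` are taken in an Abelian group, while the labels of the refinements that are excluded may lie in
any group, so that this implies fineness with respect to either class of groups. -/
def IsFineGroupGrading (H : LieSubalgebra 𝕜 A) {ι : Type} (Γ : ι → Submodule 𝕜 A) : Prop :=
  IsAbelianGroupGrading H Γ ∧
    ∀ (ι' : Type) (Γ' : ι' → Submodule 𝕜 A),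
      IsGroupGrading H Γ' → IsRefinement Γ Γ' → Set.range Γ' = Set.range Γ

end Gradings

/-! ### The complex Lie algebras, and real forms -/

/-- Complex `4 × 4` matrices. -/
abbrev M4 : Type := Matrix (Fin 4) (Fin 4) ℂ

/-- `sl(4, ℂ)`. -/
abbrev sl4 : LieSubalgebra ℂ M4 := LieAlgebra.SpecialLinear.sl (Fin 4) ℂ

/-- `o_K(4, ℂ)`. -/
def oAlg (K : M4) : LieSubalgebra ℂ M4 where
  carrier := {X | X * K = -(K * Xᵀ)}
  add_mem' := by
    intro X Y hX hY
    change X * K = -(K * Xᵀ) at hX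
    change Y * K = -(K * Yᵀ) at hY
    change (X + Y) * K = -(K * (X + Y)ᵀ)
    rw [add_mul, hX, hY, transpose_add, mul_add, neg_add]
  zero_mem' := by simp
  smul_mem' := by
    intro c X hX
    change X * K = -(K * Xᵀ) at hX
    change (c • X) * K = -(K * (c • X)ᵀ)
    rw [smul_mul_assoc, hX, transpose_smul, mul_smul_comm, smul_neg]
  lie_mem' := by
    intro X Y hX hY
    change X * K = -(K * Xᵀ) at hX
    change Y * K = -(K * Yᵀ) at hY
    change ⁅X, Y⁆ * K = -(K * ⁅X, Y⁆ᵀ)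
    simp only [Ring.lie_def, sub_mul, transpose_sub, transpose_mul, mul_sub, Matrix.mul_assoc, hX,
      hY, mul_neg]
    simp only [← Matrix.mul_assoc, hX, hY, neg_mul, neg_neg, neg_sub]

/-- The real subalgebra `{X ∈ sl(4, ℂ) | X F = F X̄}`, the fixed points of `X ↦ conj (F⁻¹ X F)`
if `F` is invertible. -/
def suStar (F : M4) : LieSubalgebra ℝ M4 where
  carrier := {X | X.trace = 0 ∧ X * F = F * X.map (starRingEnd ℂ)}
  add_mem' := by
    rintro X Y ⟨tX, hX⟩ ⟨tY, hY⟩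
    refine ⟨by rw [trace_add, tX, tY, add_zero], ?_⟩
    rw [add_mul, hX, hY, Matrix.map_add _ (map_add _), mul_add]
  zero_mem' := by simp
  smul_mem' := by
    rintro c X ⟨tX, hX⟩
    refine ⟨by rw [trace_smul, tX, smul_zero], ?_⟩
    have h : (c • X).map (starRingEnd ℂ) = c • X.map (starRingEnd ℂ) := by
      ext i j; simp
    rw [smul_mul_assoc, hX, h, mul_smul_comm]
  lie_mem' := by
    rintro X Y ⟨tX, hX⟩ ⟨tY, hY⟩
    change _ ∧ _
    refine ⟨by rw [Ring.lie_def, trace_sub, trace_mul_comm, sub_self], ?_⟩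
    have h : (⁅X, Y⁆ : M4).map (starRingEnd ℂ) =
        X.map (starRingEnd ℂ) * Y.map (starRingEnd ℂ) -
          Y.map (starRingEnd ℂ) * X.map (starRingEnd ℂ) := by
      rw [Ring.lie_def, Matrix.map_sub _ (map_sub _), Matrix.map_mul, Matrix.map_mul]
    rw [h, Ring.lie_def, sub_mul, mul_sub, Matrix.mul_assoc, hY, ← Matrix.mul_assoc, hX,
      Matrix.mul_assoc, Matrix.mul_assoc Y, hX, ← Matrix.mul_assoc Y, hY, Matrix.mul_assoc]

/-- The real subalgebra `{X ∈ sl(4, ℂ) | X E = -E Xᴴ}`, the fixed points of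
`X ↦ conj (-(E⁻¹ X E)ᵀ)` if `E` is invertible and hermitian. -/
def su (E : M4) : LieSubalgebra ℝ M4 where
  carrier := {X | X.trace = 0 ∧ X * E = -(E * Xᴴ)}
  add_mem' := by
    rintro X Y ⟨tX, hX⟩ ⟨tY, hY⟩
    refine ⟨by rw [trace_add, tX, tY, add_zero], ?_⟩
    rw [add_mul, hX, hY, conjTranspose_add, mul_add, neg_add]
  zero_mem' := by simp
  smul_mem' := by
    rintro c X ⟨tX, hX⟩
    refine ⟨by rw [trace_smul, tX, smul_zero], ?_⟩
    rw [smul_mul_assoc, hX, conjTranspose_smul, star_trivial, mul_smul_comm, smul_neg]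
  lie_mem' := by
    rintro X Y ⟨tX, hX⟩ ⟨tY, hY⟩
    change _ ∧ _
    refine ⟨by rw [Ring.lie_def, trace_sub, trace_mul_comm, sub_self], ?_⟩
    simp only [Ring.lie_def, sub_mul, conjTranspose_sub, conjTranspose_mul, mul_sub,
      Matrix.mul_assoc, hX, hY, mul_neg]
    simp only [← Matrix.mul_assoc, hX, hY, neg_mul, neg_neg, neg_sub]

/-- `F` is anticircular; then `suStar F` is a representation of `su*(4)`. -/
def IsAnticircular (F : M4) : Prop := F * F.map (starRingEnd ℂ) = -1

/-- `E` is hermitian with `p` positive, no zero, and `q` negative eigenvalues, where `p + q = 4`;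
then `su E` is a representation of `su(p, q)`. -/
def HasSignature (E : M4) (p q : ℕ) : Prop :=
  p + q = 4 ∧ ∃ hE : E.IsHermitian,
    Nat.card {i // 0 < hE.eigenvalues i} = p ∧ Nat.card {i // hE.eigenvalues i < 0} = q

/-- `P` is a real form of `L`: every element of `L` is uniquely `u + i v` with `u, v ∈ P`. -/
def IsRealForm (L : LieSubalgebra ℂ M4) (P : LieSubalgebra ℝ M4) : Prop :=
  (∀ x ∈ P, x ∈ L) ∧
    ∀ x ∈ L, ∃! w : M4 × M4, w.1 ∈ P ∧ w.2 ∈ P ∧ x = w.1 + Complex.I • w.2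

/-- The real Lie algebra `o_K(4, ℂ) ∩ P`. -/
def oInter (K : M4) (P : LieSubalgebra ℝ M4) : LieSubalgebra ℝ M4 where
  carrier := {X | X ∈ oAlg K ∧ X ∈ P}
  add_mem' := fun hX hY => ⟨add_mem hX.1 hY.1, add_mem hX.2 hY.2⟩
  zero_mem' := ⟨zero_mem _, zero_mem _⟩
  smul_mem' := by
    intro c X hX
    refine ⟨?_, P.smul_mem c hX.2⟩
    have h := (oAlg K).smul_mem (c : ℂ) hX.1
    rwa [Complex.coe_smul] at h
  lie_mem' := fun hX hY => ⟨(oAlg K).lie_mem hX.1 hY.1, P.lie_mem hX.2 hY.2⟩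

/-! ### The standard models of the real forms of `o(4, ℂ)` -/

/-- `so(p, q)`, the real matrices that are skew-adjoint for `diag(1, …, 1, -1, …, -1)`. -/
abbrev soReal (p q : ℕ) : LieSubalgebra ℝ (Matrix (Fin p ⊕ Fin q) (Fin p ⊕ Fin q) ℝ) :=
  LieAlgebra.Orthogonal.so' (Fin p) (Fin q) ℝ

/-- `so*(4)`, the complex matrices with `Xᵀ = -X` and `Xᴴ J + J X = 0`, where `J` is the standard
symplectic matrix. -/
def soStar : LieSubalgebra ℝ (Matrix (Fin 2 ⊕ Fin 2) (Fin 2 ⊕ Fin 2) ℂ) where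
  carrier := {X | Xᵀ = -X ∧ Xᴴ * Matrix.J (Fin 2) ℂ + Matrix.J (Fin 2) ℂ * X = 0}
  add_mem' := by
    rintro X Y ⟨sX, hX⟩ ⟨sY, hY⟩
    refine ⟨by rw [transpose_add, sX, sY, neg_add], ?_⟩
    rw [conjTranspose_add, add_mul, mul_add, add_add_add_comm, hX, hY, add_zero]
  zero_mem' := by simp
  smul_mem' := by
    rintro c X ⟨sX, hX⟩
    refine ⟨by rw [transpose_smul, sX, smul_neg], ?_⟩
    rw [conjTranspose_smul, star_trivial, smul_mul_assoc, mul_smul_comm, ← smul_add, hX, smul_zero]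
  lie_mem' := by
    rintro X Y ⟨sX, hX⟩ ⟨sY, hY⟩
    change _ ∧ _
    refine ⟨by simp only [Ring.lie_def, transpose_sub, transpose_mul, sX, sY]; noncomm_ring, ?_⟩
    rw [add_eq_zero_iff_eq_neg] at hX hY
    simp only [Ring.lie_def, mul_sub, conjTranspose_sub, conjTranspose_mul, sub_mul,
      Matrix.mul_assoc, hX, hY, mul_neg]
    simp only [← Matrix.mul_assoc, hX, hY, neg_mul, neg_neg]
    abel

/-! ### The gradings `Γ₃, …, Γ₈` of `sl(4, ℂ)`

The grading subspace `L_k` is the value at the index `k - 1`. -/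

/-- The matrix unit `E_{jk}`, with `j, k ∈ {1, 2, 3, 4}`. -/
def e (j k : ℕ) : M4 := Matrix.of fun a b => if a.val + 1 = j ∧ b.val + 1 = k then 1 else 0

/-- The complex span of a set of matrices. -/
abbrev sp (s : Set M4) : Submodule ℂ M4 := Submodule.span ℂ s

def Γ₃ : Fin 13 → Submodule ℂ M4 :=
  ![sp {e 1 4 + e 4 1}, sp {e 1 4 - e 4 1}, sp {e 2 4 + e 4 2}, sp {e 2 4 - e 4 2},
    sp {e 3 4 + e 4 3}, sp {e 3 4 - e 4 3}, sp {e 1 3 + e 3 1}, sp {e 1 3 - e 3 1},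
    sp {e 2 3 + e 3 2}, sp {e 2 3 - e 3 2}, sp {e 1 2 + e 2 1}, sp {e 1 2 - e 2 1},
    sp {e 1 1 - e 2 2, e 2 2 - e 3 3, e 3 3 - e 4 4}]

def Γ₄ : Fin 14 → Submodule ℂ M4 :=
  ![sp {e 1 3 - e 4 1}, sp {e 1 3 + e 4 1}, sp {e 1 4 - e 3 1}, sp {e 1 4 + e 3 1},
    sp {e 2 4 - e 3 2}, sp {e 2 4 + e 3 2}, sp {e 2 3 - e 4 2}, sp {e 2 3 + e 4 2},
    sp {e 1 2 - e 2 1}, sp {e 1 2 + e 2 1}, sp {e 3 4}, sp {e 4 3},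
    sp {e 3 3 - e 4 4}, sp {e 1 1 - e 2 2, e 1 1 + e 2 2 - e 3 3 - e 4 4}]

def Γ₅ : Fin 14 → Submodule ℂ M4 :=
  ![sp {e 2 3 - e 4 1}, sp {e 2 3 + e 4 1}, sp {e 2 4 - e 3 1}, sp {e 2 4 + e 3 1},
    sp {e 1 3 - e 4 2}, sp {e 1 3 + e 4 2}, sp {e 1 4 - e 3 2}, sp {e 1 4 + e 3 2},
    sp {e 1 2}, sp {e 2 1}, sp {e 3 4}, sp {e 4 3},
    sp {e 1 1 + e 2 2 - e 3 3 - e 4 4},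
    sp {e 1 1 - e 2 2 + e 3 3 - e 4 4, e 1 1 - e 2 2 - e 3 3 + e 4 4}]

def Γ₆ : Fin 15 → Submodule ℂ M4 :=
  ![sp {e 1 1 - e 2 2 + e 3 3 - e 4 4}, sp {e 1 1 - e 2 2 - e 3 3 + e 4 4},
    sp {e 1 1 + e 2 2 - e 3 3 - e 4 4}, sp {e 1 3 - e 2 4 + e 3 1 - e 4 2},
    sp {e 1 3 + e 2 4 - e 3 1 - e 4 2}, sp {e 1 3 + e 2 4 + e 3 1 + e 4 2},
    sp {e 1 3 - e 2 4 - e 3 1 + e 4 2}, sp {e 2 1 + e 4 3}, sp {e 2 1 - e 4 3},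
    sp {e 1 4 - e 3 2}, sp {e 1 4 + e 3 2}, sp {e 2 3 - e 4 1}, sp {e 2 3 + e 4 1},
    sp {e 1 2 + e 3 4}, sp {e 1 2 - e 3 4}]

def Γ₇ : Fin 15 → Submodule ℂ M4 :=
  ![sp {e 1 4 + e 2 3 + e 3 2 + e 4 1}, sp {e 1 4 - e 2 3 - e 3 2 + e 4 1},
    sp {e 1 4 - e 2 3 + e 3 2 - e 4 1}, sp {e 1 4 + e 2 3 - e 3 2 - e 4 1},
    sp {e 1 3 + e 2 4 + e 3 1 + e 4 2}, sp {e 1 3 - e 2 4 - e 3 1 + e 4 2},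
    sp {e 1 3 - e 2 4 + e 3 1 - e 4 2}, sp {e 1 3 + e 2 4 - e 3 1 - e 4 2},
    sp {e 1 2 + e 2 1 + e 3 4 + e 4 3}, sp {e 1 2 - e 2 1 - e 3 4 + e 4 3},
    sp {e 1 2 - e 2 1 + e 3 4 - e 4 3}, sp {e 1 2 + e 2 1 - e 3 4 - e 4 3},
    sp {e 1 1 - e 2 2 - e 3 3 + e 4 4}, sp {e 1 1 - e 2 2 + e 3 3 - e 4 4},
    sp {e 1 1 + e 2 2 - e 3 3 - e 4 4}]

def Γ₈ : Fin 14 → Submodule ℂ M4 :=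
  ![sp {e 1 3 + e 2 4 + e 3 2 + e 4 1}, sp {e 1 3 - e 2 4 - e 3 2 + e 4 1},
    sp {e 1 3 - e 2 4 + e 3 2 - e 4 1}, sp {e 1 3 + e 2 4 - e 3 2 - e 4 1},
    sp {e 1 4 + e 2 3 + e 3 1 + e 4 2}, sp {e 1 4 - e 2 3 - e 3 1 + e 4 2},
    sp {e 1 4 - e 2 3 + e 3 1 - e 4 2}, sp {e 1 4 + e 2 3 - e 3 1 - e 4 2},
    sp {e 1 1 + e 2 2 - e 3 3 - e 4 4}, sp {e 1 1 - e 2 2}, sp {e 3 3 - e 4 4},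
    sp {e 1 2 - e 2 1}, sp {e 3 4 - e 4 3}, sp {e 1 2 + e 2 1, e 3 4 + e 4 3}]

/-! The grading subspaces that make up `o_K(4, ℂ)` (again `L_k` has the index `k - 1`). -/

/-- `L₂, L₄, L₆, L₈, L₁₀, L₁₂`. -/
def S₃ : Set (Fin 13) := {1, 3, 5, 7, 9, 11}

/-- `L₁₃, L₁, L₅, L₉, L₇, L₃`. -/
def S₄ : Set (Fin 14) := {12, 0, 4, 8, 6, 2}

/-- `L₁₄, L₁, L₃, L₅, L₇`. -/
def S₅ : Set (Fin 14) := {13, 0, 2, 4, 6}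

/-- `L₁, L₂, L₁₀, L₄, L₅, L₁₂`. -/
def S₆ : Set (Fin 15) := {0, 1, 9, 3, 4, 11}

/-- `L₃, L₄, L₈, L₆, L₁₁, L₁₀`. -/
def S₇ : Set (Fin 15) := {2, 3, 7, 5, 10, 9}

/-- `L₁₁, L₄, L₃, L₁₂, L₈, L₆`. -/
def S₈ : Set (Fin 14) := {10, 3, 2, 11, 7, 5}

/-! ### The defining matrices -/

def K₁ : M4 := 1

def K₂ : M4 := !![1, 0, 0, 0; 0, 1, 0, 0; 0, 0, 0, 1; 0, 0, 1, 0]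

def K₃ : M4 := !![0, 1, 0, 0; 1, 0, 0, 0; 0, 0, 0, 1; 0, 0, 1, 0]

def F₁ : M4 := !![0, 0, 1, 0; 0, 0, 0, 1; -1, 0, 0, 0; 0, -1, 0, 0]

def F₂ : M4 :=
  !![0, 1, 0, 0; -1, 0, 0, 0; 0, 0, 0, Complex.I; 0, 0, -Complex.I, 0]

def E40₁ : M4 := 1

def E31₁ : M4 := !![1, 0, 0, 0; 0, 1, 0, 0; 0, 0, 1, 0; 0, 0, 0, -1]

def E31₂ : M4 := !![1, 0, 0, 0; 0, 1, 0, 0; 0, 0, 0, 1; 0, 0, 1, 0]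

def E22₁ : M4 := !![1, 0, 0, 0; 0, 1, 0, 0; 0, 0, -1, 0; 0, 0, 0, -1]

def E22₂ : M4 := !![1, 0, 0, 0; 0, -1, 0, 0; 0, 0, 0, 1; 0, 0, 1, 0]

def E22₃ : M4 := !![0, 1, 0, 0; 1, 0, 0, 0; 0, 0, 0, 1; 0, 0, 1, 0]

def E22₅ : M4 :=
  !![1, 0, 0, 0; 0, -1, 0, 0; 0, 0, 0, Complex.I; 0, 0, -Complex.I, 0]

/-! ### Gradings of real forms that are displayed by a grading of `sl(4, ℂ)` -/

/-- The real subspaces `L_k ∩ P`. -/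
def realPart {ι : Type} (Γ : ι → Submodule ℂ M4) (P : LieSubalgebra ℝ M4) (k : ι) :
    Submodule ℝ M4 :=
  (Γ k).restrictScalars ℝ ⊓ P.toSubmodule

/-- The fine group grading `Γ` of `sl(4, ℂ)` determines the fine group grading `(L_k ∩ P)_k` of
the real form `P`: each `L_k` has a complex basis in `P`. -/
structure Determines {ι : Type} (Γ : ι → Submodule ℂ M4) (P : LieSubalgebra ℝ M4) : Prop where
  fine_complex : IsFineGroupGrading sl4 Γ
  realForm : IsRealForm sl4 P
  span_eq : ∀ k, Submodule.span ℂ (realPart Γ P k : Set M4) = Γ k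
  fine_real : IsFineGroupGrading P (realPart Γ P)

/-- The grading `(L_k ∩ P)_k` of `P` displays the real form `o_K(4, ℂ) ∩ P` of `o_K(4, ℂ)`, which is
isomorphic to `R`: this subalgebra is the sum of the grading subspaces with index in `S`, and they
form a fine group grading of it. -/
structure Displays {ι : Type} (Γ : ι → Submodule ℂ M4) (S : Set ι) (K : M4)
    (P : LieSubalgebra ℝ M4) (R : Type) [LieRing R] [LieAlgebra ℝ R] : Prop where
  determines : Determines Γ P
  symm : Kᵀ = K
  det_ne_zero : K.det ≠ 0
  realForm : IsRealForm (oAlg K) (oInter K P)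
  iso : Nonempty (oInter K P ≃ₗ⁅ℝ⁆ R)
  display_complex : (oAlg K).toSubmodule = ⨆ k : S, Γ k
  display : (oInter K P).toSubmodule = ⨆ k : S, realPart Γ P k
  fine : IsFineGroupGrading (oInter K P) (fun k : S => realPart Γ P k)

end FineGradings

end

/-!
Fineness is a statement about labels. If `0 ≠ [u, x]` for `x` in a line `L_l`, and `[u, L_l] = L_m`
is a line again, then in every group grading that refines the given one both lines survive, so the
label of a homogeneous `u` is determined by `l` and `m`; if `l = m`, it is the neutral element. Each
of the gradings has at most one component that is not a line, and any two nonzero elements `u`, `v`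
of this component have such a pair `(l, m)` in common, or both preserve a line. Hence homogeneous
pieces of the component all have the same label, and there is only one of them. The grading
`(L_k ∩ P)_k` inherits the labels and the moved lines from `Γ`. Its part that makes up
`o_K(4, ℂ) ∩ P` consists of lines, except for the plane `L_14` of `Γ₅`, which preserves the lines of
that part.

All the gradings have integral bases that are orthogonal for `tr (X Yᵀ)`, so that the degrees of
commutators are read off from traces. A basis vector is multiplied by a Gaussian integer to lie in
`P`, and `P` and `o_K(4, ℂ)` are carried to the standard models by conjugation with a Gaussian
integral matrix `S` for which `S K Sᵀ` and `S E Sᴴ`, or `S K Sᵀ` and `S F S̄⁻¹`, are multiples of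
the standard forms. This leaves decidable identities of matrices.
-/

noncomputable section

namespace FineGradings

/-! ### Refinements of group gradings -/

section Refinements

variable {𝕜 A : Type} [Field 𝕜] [LieRing A] [LieAlgebra 𝕜 A]
variable {ι ι' : Type} {Γ : ι → Submodule 𝕜 A} {Γ' : ι' → Submodule 𝕜 A}

theorem eq_of_mem_of_mem (h : iSupIndep Γ) {i j : ι} {x : A} (hx : x ≠ 0) (hi : x ∈ Γ i)
    (hj : x ∈ Γ j) : i = j := by
  by_contra hij
  exact hx (Submodule.disjoint_def.1 (h.pairwiseDisjoint hij) x hi hj)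

theorem IsGroupLabelling.apply_eq_mul {G : Type} [Group G] {d : ι → G}
    (hd : IsGroupLabelling Γ d) (hΓ : iSupIndep Γ) {k l m : ι} {x y : A} (hx : x ∈ Γ k)
    (hy : y ∈ Γ l) (h0 : ⁅x, y⁆ ≠ 0) (hm : ⁅x, y⁆ ∈ Γ m) : d m = d k * d l := by
  obtain ⟨n, hn, hxy⟩ := hd.2 k l ⟨x, hx, y, hy, h0⟩
  rw [← hn, eq_of_mem_of_mem hΓ h0 hm (hxy x hx y hy)]

/-- The subspaces `Γ' i` refine the subspaces `Γ k`, where `f` assigns to each `Γ' i` the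
subspace `Γ (f i)` that it is a part of. -/
def RefinesAlong (Γ : ι → Submodule 𝕜 A) (Γ' : ι' → Submodule 𝕜 A) (f : ι' → ι) : Prop :=
  ∀ k, Γ k = ⨆ i : {i // f i = k}, Γ' i

namespace RefinesAlong

variable {f : ι' → ι}

theorem le (hf : RefinesAlong Γ Γ' f) (i : ι') : Γ' i ≤ Γ (f i) := by
  rw [hf (f i)]
  exact le_iSup (fun j : {j // f j = f i} => Γ' j) ⟨i, rfl⟩

theorem surjective (hf : RefinesAlong Γ Γ' f) (hΓ : ∀ k, Γ k ≠ ⊥) : Function.Surjective f := by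
  intro k
  by_contra! hk
  have : IsEmpty {i // f i = k} := ⟨fun i => hk i i.2⟩
  exact hΓ k (by rw [hf k, iSup_of_empty])

theorem eq_of_isAtom (hf : RefinesAlong Γ Γ' f) {i : ι'} (hi : Γ' i ≠ ⊥) (h : IsAtom (Γ (f i))) :
    Γ' i = Γ (f i) :=
  (h.le_iff.1 (hf.le i)).resolve_left hi

theorem range_eq (hf : RefinesAlong Γ Γ' f) (hΓ : ∀ k, Γ k ≠ ⊥) (hinj : Function.Injective f) :
    Set.range Γ' = Set.range Γ := by
  have heq : Γ' = Γ ∘ f := by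
    funext i
    refine le_antisymm (hf.le i) ?_
    rw [Function.comp_apply, hf (f i)]
    exact iSup_le fun j => by rw [hinj j.2]
  rw [heq, (hf.surjective hΓ).range_comp]

end RefinesAlong

/-- `ad u` maps the line `Γ l` onto the line `Γ m`; lines are encoded as atoms of the lattice of
subspaces. -/
structure Moves (Γ : ι → Submodule 𝕜 A) (u : A) (l m : ι) : Prop where
  isAtom_left : IsAtom (Γ l)
  isAtom_right : IsAtom (Γ m)
  exists_ne_zero : ∃ x ∈ Γ l, ⁅u, x⁆ ≠ 0
  lie_mem : ∀ x ∈ Γ l, ⁅u, x⁆ ∈ Γ m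

/-- A sufficient condition for `Γ k` to be a homogeneous component of every group grading that
refines `Γ`: if it is not a line, then any two of its nonzero elements either move the same line
to the same line, or both preserve a line. -/
def IsUnsplittable (Γ : ι → Submodule 𝕜 A) (k : ι) : Prop :=
  IsAtom (Γ k) ∨ ∀ u ∈ Γ k, ∀ v ∈ Γ k, u ≠ 0 → v ≠ 0 →
    (∃ l m, Moves Γ u l m ∧ Moves Γ v l m) ∨ ∃ l m, Moves Γ u l l ∧ Moves Γ v m m

/-- Lines are not refined, so a line that is moved to another line determines the label of the
element that moves it. -/
theorem Moves.label_eq {u : A} {f : ι' → ι} {p q : ι'} (h : Moves Γ u (f p) (f q))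
    (hf : RefinesAlong Γ Γ' f) (hΓ' : ∀ i, Γ' i ≠ ⊥) (hind : iSupIndep Γ') {G : Type} [Group G]
    {d : ι' → G} (hd : IsGroupLabelling Γ' d) {i : ι'} (hu : u ∈ Γ' i) : d q = d i * d p := by
  obtain ⟨x, hx, h0⟩ := h.exists_ne_zero
  have hxq := h.lie_mem x hx
  rw [← hf.eq_of_isAtom (hΓ' _) h.isAtom_left] at hx
  rw [← hf.eq_of_isAtom (hΓ' _) h.isAtom_right] at hxq
  exact hd.apply_eq_mul hind hu hx h0 hxq

theorem RefinesAlong.injective_of_isUnsplittable {f : ι' → ι} (hf : RefinesAlong Γ Γ' f)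
    (hu : ∀ k, IsUnsplittable Γ k) (hΓ : ∀ k, Γ k ≠ ⊥) (hΓ' : ∀ i, Γ' i ≠ ⊥)
    (hind : iSupIndep Γ') {G : Type} [Group G] {d : ι' → G} (hd : IsGroupLabelling Γ' d) :
    Function.Injective f := by
  intro i j hij
  obtain ⟨u, hui, hu0⟩ := Submodule.exists_mem_ne_zero_of_ne_bot (hΓ' i)
  obtain ⟨v, hvj, hv0⟩ := Submodule.exists_mem_ne_zero_of_ne_bot (hΓ' j)
  have hvi : v ∈ Γ (f i) := hij ▸ hf.le j hvj
  rcases hu (f i) with hatom | hmoves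
  · rw [← hf.eq_of_isAtom (hΓ' i) hatom] at hvi
    exact eq_of_mem_of_mem hind hv0 hvi hvj
  apply hd.1
  rcases hmoves u (hf.le i hui) v hvi hu0 hv0 with ⟨l, m, hul, hvl⟩ | ⟨l, m, hul, hvm⟩ <;>
    obtain ⟨p, rfl⟩ := hf.surjective hΓ l <;> obtain ⟨q, rfl⟩ := hf.surjective hΓ m
  · have hdi := hul.label_eq hf hΓ' hind hd hui
    have hdj := hvl.label_eq hf hΓ' hind hd hvj
    exact mul_right_cancel (hdi.symm.trans hdj)
  · have hdi := hul.label_eq hf hΓ' hind hd hui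
    have hdj := hvm.label_eq hf hΓ' hind hd hvj
    rw [right_eq_mul] at hdi hdj
    rw [hdi, hdj]

theorem IsAbelianGroupGrading.isFineGroupGrading {H : LieSubalgebra 𝕜 A}
    (hΓ : IsAbelianGroupGrading H Γ) (hu : ∀ k, IsUnsplittable Γ k) : IsFineGroupGrading H Γ := by
  refine ⟨hΓ, ?_⟩
  rintro ι' Γ' ⟨hΓ', G, _, d, hd⟩ ⟨f, hf : RefinesAlong Γ Γ' f⟩
  exact hf.range_eq hΓ.1.ne_bot
    (hf.injective_of_isUnsplittable hu hΓ.1.ne_bot hΓ'.ne_bot hΓ'.independent hd)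

end Refinements

/-! ### Parts of group gradings -/

section Restrict

variable {𝕜 A : Type} [Field 𝕜] [LieRing A] [LieAlgebra 𝕜 A] {ι : Type} {Γ : ι → Submodule 𝕜 A}

theorem IsGroupLabelling.isGrading {G : Type} [Group G] {d : ι → G} (hd : IsGroupLabelling Γ d)
    [Nonempty ι] {H : LieSubalgebra 𝕜 A} (hne : ∀ k, Γ k ≠ ⊥) (hind : iSupIndep Γ)
    (hH : ⨆ k, Γ k = H.toSubmodule) : IsGrading H Γ := by
  refine ⟨hne, hind, hH, fun k l => ?_⟩
  by_cases h : ∃ x ∈ Γ k, ∃ y ∈ Γ l, ⁅x, y⁆ ≠ 0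
  · obtain ⟨m, -, hm⟩ := hd.2 k l h
    exact ⟨m, hm⟩
  · push Not at h
    exact ⟨Classical.arbitrary ι, fun x hx y hy => h x hx y hy ▸ zero_mem _⟩

theorem mem_of_mem_iSup (hind : iSupIndep Γ) {S : Set ι} {m : ι} {x : A} (h0 : x ≠ 0)
    (hm : x ∈ Γ m) (hS : x ∈ ⨆ k : S, Γ k) : m ∈ S := by
  by_contra hmS
  have hle : ⨆ k : S, Γ k ≤ ⨆ (j : ι) (_ : j ≠ m), Γ j :=
    iSup_le fun k => le_iSup₂_of_le k.1 (fun h => hmS (h ▸ k.2)) le_rfl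
  exact h0 (Submodule.disjoint_def.1 (hind m) x hm (hle hS))

theorem IsAbelianGroupGrading.restrict {H H' : LieSubalgebra 𝕜 A}
    (hΓ : IsAbelianGroupGrading H Γ) {S : Set ι} (hS : S.Nonempty)
    (hH' : H'.toSubmodule = ⨆ k : S, Γ k) : IsAbelianGroupGrading H' (fun k : S => Γ k) := by
  obtain ⟨hg, G, _, d, hd⟩ := hΓ
  have hle (k : S) : Γ k ≤ H'.toSubmodule := hH' ▸ le_iSup (fun k : S => Γ k) k
  have hlabel : IsGroupLabelling (fun k : S => Γ k) (fun k : S => d k) := by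
    refine ⟨hd.1.comp Subtype.val_injective, fun k l hkl => ?_⟩
    obtain ⟨m, hm, hmb⟩ := hd.2 k l hkl
    obtain ⟨x, hx, y, hy, hxy⟩ := hkl
    have hxyH' : ⁅x, y⁆ ∈ H'.toSubmodule := H'.lie_mem (hle k hx) (hle l hy)
    have hmS : m ∈ S := mem_of_mem_iSup hg.independent hxy (hmb x hx y hy) (hH' ▸ hxyH')
    exact ⟨⟨m, hmS⟩, hm, hmb⟩
  have := hS.to_subtype
  exact ⟨hlabel.isGrading (fun k => hg.ne_bot k)
    (hg.independent.comp Subtype.val_injective) hH'.symm, G, _, _, hlabel⟩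

end Restrict

/-! ### Homogeneous bases -/

section HomogeneousBasis

variable {𝕜 A : Type} [Field 𝕜] [LieRing A] [LieAlgebra 𝕜 A]

/-- The linearly independent family `b` consists of elements `b i` of the subspaces `Γ (κ i)`,
and those with `κ i = k` span `Γ k`. -/
structure IsHomogeneousBasis {ι n : Type} (Γ : ι → Submodule 𝕜 A) (b : n → A) (κ : n → ι) :
    Prop where
  linearIndependent : LinearIndependent 𝕜 b
  eq_span : ∀ k, Γ k = Submodule.span 𝕜 (b '' (κ ⁻¹' {k}))
  surjective : Function.Surjective κ

namespace IsHomogeneousBasis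

variable {ι n : Type} {Γ : ι → Submodule 𝕜 A} {b : n → A} {κ : n → ι}

theorem mem (h : IsHomogeneousBasis Γ b κ) (i : n) : b i ∈ Γ (κ i) := by
  rw [h.eq_span]
  exact Submodule.subset_span ⟨i, rfl, rfl⟩

theorem ne_bot (h : IsHomogeneousBasis Γ b κ) (k : ι) : Γ k ≠ ⊥ := by
  obtain ⟨i, rfl⟩ := h.surjective k
  exact Submodule.ne_bot_iff _ |>.2 ⟨b i, h.mem i, h.linearIndependent.ne_zero i⟩

theorem iSup_subtype (h : IsHomogeneousBasis Γ b κ) (S : Set ι) :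
    ⨆ k : S, Γ k = Submodule.span 𝕜 (b '' (κ ⁻¹' S)) := by
  simp only [h.eq_span, ← Submodule.span_iUnion, ← Set.image_iUnion, ← Set.preimage_iUnion,
    Set.iUnion_of_singleton_coe]

theorem iSup_eq (h : IsHomogeneousBasis Γ b κ) : ⨆ k, Γ k = Submodule.span 𝕜 (Set.range b) := by
  simp only [h.eq_span, ← Submodule.span_iUnion, ← Set.image_iUnion, ← Set.preimage_iUnion,
    Set.iUnion_of_singleton, Set.preimage_univ, Set.image_univ]

theorem iSupIndep (h : IsHomogeneousBasis Γ b κ) : iSupIndep Γ := by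
  intro k
  have hne : ⨆ (j) (_ : j ≠ k), Γ j = Submodule.span 𝕜 (b '' (κ ⁻¹' {k}ᶜ)) := by
    rw [← h.iSup_subtype, iSup_subtype']
    rfl
  rw [hne, h.eq_span]
  exact h.linearIndependent.disjoint_span_image (disjoint_compl_right.preimage κ)

theorem eq_span_singleton (h : IsHomogeneousBasis Γ b κ) {i : n} (hi : ∀ j, κ j = κ i → j = i) :
    Γ (κ i) = Submodule.span 𝕜 {b i} := by
  have hκ : κ ⁻¹' {κ i} = {i} := Set.ext fun j => ⟨hi j, fun hj => congrArg κ hj⟩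
  rw [h.eq_span, hκ, Set.image_singleton]

theorem isAtom (h : IsHomogeneousBasis Γ b κ) {i : n} (hi : ∀ j, κ j = κ i → j = i) :
    IsAtom (Γ (κ i)) := by
  rw [h.eq_span_singleton hi]
  exact nonzero_span_atom _ (h.linearIndependent.ne_zero i)

theorem lie_mem_span (h : IsHomogeneousBasis Γ b κ) {G : Type} [AddCommGroup G] {d : ι → G}
    (hbr : ∀ i j, ⁅b i, b j⁆ ∈ Submodule.span 𝕜 (b '' {m | d (κ m) = d (κ i) + d (κ j)}))
    {k l : ι} {x y : A} (hx : x ∈ Γ k) (hy : y ∈ Γ l) :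
    ⁅x, y⁆ ∈ Submodule.span 𝕜 (b '' {m | d (κ m) = d k + d l}) := by
  rw [h.eq_span] at hx hy
  refine LinearMap.BilinMap.apply_apply_mem_of_mem_span _ _ _ (LieModule.toEnd 𝕜 A A).toLinearMap
    ?_ x y hx hy
  rintro _ ⟨i, rfl, rfl⟩ _ ⟨j, rfl, rfl⟩
  exact hbr i j

theorem isAbelianGroupGrading [Nonempty ι] (h : IsHomogeneousBasis Γ b κ) {H : LieSubalgebra 𝕜 A}
    (hH : Submodule.span 𝕜 (Set.range b) = H.toSubmodule) {G : Type} [AddCommGroup G] {d : ι → G}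
    (hd : Function.Injective d)
    (hbr : ∀ i j, ⁅b i, b j⁆ ∈ Submodule.span 𝕜 (b '' {m | d (κ m) = d (κ i) + d (κ j)})) :
    IsAbelianGroupGrading H Γ := by
  have hlabel : IsGroupLabelling Γ (Multiplicative.ofAdd ∘ d) := by
    refine ⟨Multiplicative.ofAdd.injective.comp hd, ?_⟩
    rintro k l ⟨x, hx, y, hy, hxy⟩
    obtain ⟨i, hi⟩ : ∃ i, d (κ i) = d k + d l := by
      by_contra! hne
      have hmem := h.lie_mem_span hbr hx hy
      rw [Set.eq_empty_of_forall_notMem (s := {m | d (κ m) = d k + d l}) hne, Set.image_empty,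
        Submodule.span_empty, Submodule.mem_bot] at hmem
      exact hxy hmem
    refine ⟨κ i, congrArg Multiplicative.ofAdd hi, fun x hx y hy => ?_⟩
    have hset : {m | d (κ m) = d k + d l} = κ ⁻¹' {κ i} :=
      Set.ext fun m => by rw [Set.mem_ofPred_eq, ← hi, hd.eq_iff]; rfl
    rw [h.eq_span, ← hset]
    exact h.lie_mem_span hbr hx hy
  exact ⟨hlabel.isGrading h.ne_bot h.iSupIndep (h.iSup_eq.trans hH), _, _, _, hlabel⟩

end IsHomogeneousBasis

end HomogeneousBasis

/-! ### Totally real subspaces -/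

section TotallyReal

variable {V : Type} [AddCommGroup V] [Module ℂ V] [Module ℝ V]

/-- The real subspace `P` contains no complex line. -/
def IsTotallyReal (P : Submodule ℝ V) : Prop := ∀ x ∈ P, Complex.I • x ∈ P → x = 0

theorem IsTotallyReal.mono {P Q : Submodule ℝ V} (hP : IsTotallyReal P) (h : Q ≤ P) :
    IsTotallyReal Q :=
  fun x hx hIx => hP x (h hx) (h hIx)

theorem IsTotallyReal.eq_and_eq {P : Submodule ℝ V} (hP : IsTotallyReal P) {u v u' v' : V}
    (hu : u ∈ P) (hv : v ∈ P) (hu' : u' ∈ P) (hv' : v' ∈ P)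
    (h : u + Complex.I • v = u' + Complex.I • v') : u = u' ∧ v = v' := by
  have hI : Complex.I • (v - v') = u' - u := by
    rw [smul_sub, sub_eq_sub_iff_add_eq_add, add_comm, h, add_comm]
  obtain rfl : v = v' := sub_eq_zero.1 (hP _ (sub_mem hv hv') (hI ▸ sub_mem hu' hu))
  exact ⟨add_right_cancel h, rfl⟩

theorem exists_add_I_smul_of_mem_span [IsScalarTower ℝ ℂ V] {P : Submodule ℝ V}
    {x : V} (hx : x ∈ Submodule.span ℂ (P : Set V)) : ∃ u ∈ P, ∃ v ∈ P, x = u + Complex.I • v := by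
  induction hx using Submodule.span_induction with
  | mem x hx => exact ⟨x, hx, 0, zero_mem _, by rw [smul_zero, add_zero]⟩
  | zero => exact ⟨0, zero_mem _, 0, zero_mem _, by rw [smul_zero, add_zero]⟩
  | add x y _ _ hx hy =>
    obtain ⟨u, hu, v, hv, rfl⟩ := hx
    obtain ⟨u', hu', v', hv', rfl⟩ := hy
    exact ⟨u + u', add_mem hu hu', v + v', add_mem hv hv', by rw [smul_add, add_add_add_comm]⟩
  | smul c x _ hx =>
    obtain ⟨u, hu, v, hv, rfl⟩ := hx
    refine ⟨c.re • u - c.im • v, sub_mem (P.smul_mem _ hu) (P.smul_mem _ hv),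
      c.im • u + c.re • v, add_mem (P.smul_mem _ hu) (P.smul_mem _ hv), ?_⟩
    have hcoe (r : ℝ) (w : V) : r • w = (r : ℂ) • w := by
      rw [← Complex.coe_algebraMap, algebraMap_smul]
    nth_rw 1 [← Complex.re_add_im c]
    simp only [hcoe]
    match_scalars
    · ring
    · linear_combination (c.im : ℂ) * Complex.I_mul_I

theorem IsTotallyReal.mem_of_mem_span [IsScalarTower ℝ ℂ V] {P Q : Submodule ℝ V}
    (hP : IsTotallyReal P) (hQ : Q ≤ P) {x : V} (hxP : x ∈ P)
    (hx : x ∈ Submodule.span ℂ (Q : Set V)) : x ∈ Q := by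
  obtain ⟨u, hu, v, hv, hxuv⟩ := exists_add_I_smul_of_mem_span hx
  have hxu := (hP.eq_and_eq hxP (zero_mem _) (hQ hu) (hQ hv)
    (by rwa [smul_zero, add_zero])).1
  exact hxu ▸ hu

end TotallyReal

/-! ### Gradings of real forms -/

section RealPart

theorem isRealForm_of_isTotallyReal {L : LieSubalgebra ℂ M4} {P : LieSubalgebra ℝ M4}
    (hP : IsTotallyReal P.toSubmodule) (hL : Submodule.span ℂ (P : Set M4) = L.toSubmodule) :
    IsRealForm L P := by
  have hPL (x : M4) (hx : x ∈ P) : x ∈ L.toSubmodule := hL ▸ Submodule.subset_span hx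
  refine ⟨hPL, fun x hx => ?_⟩
  obtain ⟨u, hu, v, hv, rfl⟩ := exists_add_I_smul_of_mem_span (P := P.toSubmodule)
    (hL ▸ hx : x ∈ Submodule.span ℂ (P : Set M4))
  refine ⟨(u, v), ⟨hu, hv, rfl⟩, ?_⟩
  rintro ⟨u', v'⟩ ⟨hu', hv', h⟩
  obtain ⟨rfl, rfl⟩ := hP.eq_and_eq hu hv hu' hv' h
  rfl

variable {ι : Type} {Γ : ι → Submodule ℂ M4} {P : LieSubalgebra ℝ M4}

theorem realPart_le (k : ι) : realPart Γ P k ≤ P.toSubmodule := inf_le_right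

theorem iSup_realPart_le : ⨆ k, realPart Γ P k ≤ P.toSubmodule := iSup_le realPart_le

theorem iSupIndep_realPart (hΓ : iSupIndep Γ) : iSupIndep (realPart Γ P) := by
  intro k
  have hle : ⨆ (j) (_ : j ≠ k), realPart Γ P j ≤
      (⨆ (j) (_ : j ≠ k), Γ j : Submodule ℂ M4).restrictScalars ℝ :=
    iSup₂_le fun j hj x hx => le_iSup₂ (f := fun j (_ : j ≠ k) => Γ j) j hj hx.1
  exact Submodule.disjoint_def.2 fun x hx hx' => Submodule.disjoint_def.1 (hΓ k) x hx.1 (hle hx')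

theorem span_ne_bot {W : Submodule ℝ M4} (hW : W ≠ ⊥) : Submodule.span ℂ (W : Set M4) ≠ ⊥ := by
  rw [Ne, Submodule.span_eq_bot]
  exact fun h => hW ((Submodule.eq_bot_iff W).2 h)

/-- Each `Γ k` has a complex basis in `P`. -/
def IsSpannedBy (Γ : ι → Submodule ℂ M4) (P : LieSubalgebra ℝ M4) : Prop :=
  ∀ k, Submodule.span ℂ (realPart Γ P k : Set M4) = Γ k

namespace IsSpannedBy

theorem span_iSup_realPart (hΓ : IsSpannedBy Γ P) :
    Submodule.span ℂ ((⨆ k, realPart Γ P k : Submodule ℝ M4) : Set M4) = ⨆ k, Γ k := by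
  rw [Submodule.iSup_eq_span, Submodule.span_span_of_tower, Submodule.span_iUnion]
  exact iSup_congr hΓ

theorem iSup_realPart (hΓ : IsSpannedBy Γ P) (hP : IsTotallyReal P.toSubmodule) :
    ⨆ k, realPart Γ P k = (⨆ k, Γ k).restrictScalars ℝ ⊓ P.toSubmodule := by
  refine le_antisymm (iSup_le fun k => inf_le_inf_right _ ?_) fun x hx => ?_
  · exact fun x hx => le_iSup Γ k hx
  · exact hP.mem_of_mem_span iSup_realPart_le hx.2 (hΓ.span_iSup_realPart ▸ hx.1)

theorem span_eq (hΓ : IsSpannedBy Γ P) {L : LieSubalgebra ℂ M4} (hL : ⨆ k, Γ k = L.toSubmodule)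
    (hPL : ∀ x ∈ P, x ∈ L) : Submodule.span ℂ (P : Set M4) = L.toSubmodule := by
  refine le_antisymm (Submodule.span_le.2 hPL) ?_
  rw [← hL, ← hΓ.span_iSup_realPart]
  exact Submodule.span_mono iSup_realPart_le

theorem isRealForm (hΓ : IsSpannedBy Γ P) (hP : IsTotallyReal P.toSubmodule)
    {L : LieSubalgebra ℂ M4} (hL : ⨆ k, Γ k = L.toSubmodule) (hPL : ∀ x ∈ P, x ∈ L) :
    IsRealForm L P :=
  isRealForm_of_isTotallyReal hP (hΓ.span_eq hL hPL)

theorem realPart_ne_bot (hΓ : IsSpannedBy Γ P) {k : ι} (hk : Γ k ≠ ⊥) : realPart Γ P k ≠ ⊥ := by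
  contrapose! hk
  rw [← hΓ k, hk, Submodule.bot_coe, Submodule.span_zero_singleton]

theorem isAbelianGroupGrading (hΓ : IsSpannedBy Γ P) (hP : IsTotallyReal P.toSubmodule)
    {L : LieSubalgebra ℂ M4} (hg : IsAbelianGroupGrading L Γ) (hPL : ∀ x ∈ P, x ∈ L) :
    IsAbelianGroupGrading P (realPart Γ P) := by
  obtain ⟨hg, G, _, d, dinj, hd⟩ := hg
  refine ⟨⟨fun k => hΓ.realPart_ne_bot (hg.ne_bot k), iSupIndep_realPart hg.independent, ?_,
    fun k l => ?_⟩, G, ‹_›, d, dinj, ?_⟩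
  · rw [hΓ.iSup_realPart hP, hg.iSup_eq]
    exact inf_eq_right.2 hPL
  · obtain ⟨m, hm⟩ := hg.bracket k l
    exact ⟨m, fun x hx y hy => ⟨hm x hx.1 y hy.1, P.lie_mem hx.2 hy.2⟩⟩
  · rintro k l ⟨x, hx, y, hy, hxy⟩
    obtain ⟨m, hm, hmb⟩ := hd k l ⟨x, hx.1, y, hy.1, hxy⟩
    exact ⟨m, hm, fun x hx y hy => ⟨hmb x hx.1 y hy.1, P.lie_mem hx.2 hy.2⟩⟩

theorem isAtom_realPart (hΓ : IsSpannedBy Γ P) (hP : IsTotallyReal P.toSubmodule) {k : ι}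
    (hk : IsAtom (Γ k)) : IsAtom (realPart Γ P k) := by
  refine ⟨hΓ.realPart_ne_bot hk.1, fun W hW => ?_⟩
  by_contra hW0
  have hle : Submodule.span ℂ (W : Set M4) ≤ Γ k := Submodule.span_le.2 fun x hx => (hW.le hx).1
  have hspan := (hk.le_iff.1 hle).resolve_left (span_ne_bot hW0)
  refine hW.not_ge fun x hx => ?_
  exact hP.mem_of_mem_span (hW.le.trans (realPart_le k)) hx.2 (hspan ▸ hx.1)

theorem moves_realPart (hΓ : IsSpannedBy Γ P) (hP : IsTotallyReal P.toSubmodule) {u : M4}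
    (hu : u ∈ P) {l m : ι} (h : Moves Γ u l m) : Moves (realPart Γ P) u l m := by
  refine ⟨hΓ.isAtom_realPart hP h.isAtom_left, hΓ.isAtom_realPart hP h.isAtom_right, ?_,
    fun x hx => ⟨h.lie_mem x hx.1, P.lie_mem hu hx.2⟩⟩
  by_contra! hzero
  obtain ⟨x, hx, h0⟩ := h.exists_ne_zero
  have hle : Γ l ≤ LinearMap.ker (LieModule.toEnd ℂ M4 M4 u) := by
    rw [← hΓ l, Submodule.span_le]
    exact hzero
  exact h0 (hle hx)

theorem isUnsplittable_realPart (hΓ : IsSpannedBy Γ P) (hP : IsTotallyReal P.toSubmodule) {k : ι}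
    (h : IsUnsplittable Γ k) : IsUnsplittable (realPart Γ P) k := by
  refine h.imp (hΓ.isAtom_realPart hP) fun h u hu v hv hu0 hv0 => ?_
  refine (h u hu.1 v hv.1 hu0 hv0).imp ?_ ?_ <;> rintro ⟨l, m, h₁, h₂⟩ <;>
    exact ⟨l, m, hΓ.moves_realPart hP hu.2 h₁, hΓ.moves_realPart hP hv.2 h₂⟩

end IsSpannedBy

end RealPart

/-! ### Trace-orthogonal families of matrices -/

section TraceOrthogonal

variable {R n m : Type} [CommRing R] [Fintype m]

/-- The family `b` is orthogonal, with no isotropic member, for the form `tr (X Yᵀ)`. -/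
def IsTraceOrthogonal (b : n → Matrix m m R) : Prop :=
  ∀ i j, (b i * (b j)ᵀ).trace = 0 ↔ i ≠ j

namespace IsTraceOrthogonal

variable {b : n → Matrix m m R}

theorem trace_linearCombination_mul_transpose (hb : IsTraceOrthogonal b) (c : n →₀ R) (j : n) :
    (Finsupp.linearCombination R b c * (b j)ᵀ).trace = c j * (b j * (b j)ᵀ).trace := by
  rw [Finsupp.linearCombination_apply, Finsupp.sum, Finset.sum_mul, trace_sum]
  simp only [smul_mul_assoc, trace_smul, smul_eq_mul]
  refine Finset.sum_eq_single j (fun i _ hij => ?_) fun hj => ?_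
  · rw [(hb i j).2 hij, mul_zero]
  · rw [Finsupp.notMem_support_iff.1 hj, zero_mul]

theorem trace_mul_transpose_self_ne_zero (hb : IsTraceOrthogonal b) (j : n) :
    (b j * (b j)ᵀ).trace ≠ 0 :=
  fun h => (hb j j).1 h rfl

theorem linearIndependent [NoZeroDivisors R] (hb : IsTraceOrthogonal b) :
    LinearIndependent R b := by
  refine linearIndependent_iff.2 fun c hc => Finsupp.ext fun j => ?_
  have h := hb.trace_linearCombination_mul_transpose c j
  rw [hc, zero_mul, trace_zero, eq_comm] at h
  exact (mul_eq_zero.1 h).resolve_right (hb.trace_mul_transpose_self_ne_zero j)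

theorem mem_span_image [NoZeroDivisors R] (hb : IsTraceOrthogonal b) {T : Set n}
    {x : Matrix m m R} (hx : x ∈ Submodule.span R (Set.range b))
    (hT : ∀ j, j ∈ T ∨ (x * (b j)ᵀ).trace = 0) : x ∈ Submodule.span R (b '' T) := by
  obtain ⟨c, rfl⟩ := (Finsupp.mem_span_range_iff_exists_finsupp).1 hx
  rw [← Finsupp.linearCombination_apply] at hT ⊢
  refine (Finsupp.mem_span_image_iff_linearCombination R).2 ⟨c, fun j hj => ?_, rfl⟩
  refine (hT j).resolve_right fun h => ?_
  rw [hb.trace_linearCombination_mul_transpose] at h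
  exact mul_ne_zero (Finsupp.mem_support_iff.1 hj) (hb.trace_mul_transpose_self_ne_zero j) h

theorem map {R' : Type} [CommRing R'] {f : R →+* R'} (hf : Function.Injective f)
    [DecidableEq m] (hb : IsTraceOrthogonal b) : IsTraceOrthogonal fun i => f.mapMatrix (b i) := by
  intro i j
  rw [← hb i j, ← map_eq_zero_iff f hf, AddMonoidHom.map_trace f, Matrix.map_mul]
  rfl

end IsTraceOrthogonal

theorem mem_sl_iff [DecidableEq m] {x : Matrix m m R} :
    x ∈ LieAlgebra.SpecialLinear.sl m R ↔ x.trace = 0 :=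
  LinearMap.mem_ker

theorem finrank_sl (𝕜 : Type) [Field 𝕜] [DecidableEq m] [Nonempty m] :
    Module.finrank 𝕜 (LieAlgebra.SpecialLinear.sl m 𝕜).toSubmodule + 1 =
      Fintype.card m * Fintype.card m := by
  have hrange : LinearMap.range (Matrix.traceLinearMap m 𝕜 𝕜) = ⊤ :=
    LinearMap.range_eq_top.2 fun c =>
      ⟨Matrix.single (Classical.arbitrary m) (Classical.arbitrary m) c, trace_single_eq_same _ _⟩
  have h := (Matrix.traceLinearMap m 𝕜 𝕜).finrank_range_add_finrank_ker
  rwa [hrange, finrank_top, Module.finrank_self, Module.finrank_matrix, Module.finrank_self,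
    mul_one, add_comm] at h

theorem IsTraceOrthogonal.span_range_eq_sl {𝕜 : Type} [Field 𝕜] [DecidableEq m] [Fintype n]
    {b : n → Matrix m m 𝕜} (hb : IsTraceOrthogonal b) (htr : ∀ i, (b i).trace = 0)
    (hcard : Fintype.card n + 1 = Fintype.card m * Fintype.card m) :
    Submodule.span 𝕜 (Set.range b) = (LieAlgebra.SpecialLinear.sl m 𝕜).toSubmodule := by
  have : Nonempty m := by
    rw [← Fintype.card_pos_iff]
    exact Nat.pos_of_ne_zero fun h => by simp [h] at hcard
  refine Submodule.eq_of_le_of_finrank_eq (Submodule.span_le.2 ?_) ?_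
  · rintro _ ⟨i, rfl⟩
    exact mem_sl_iff.2 (htr i)
  · rw [finrank_span_eq_card hb.linearIndependent]
    exact Nat.add_right_cancel (hcard.trans (finrank_sl 𝕜).symm)

theorem IsTraceOrthogonal.lie_mem_span {𝕜 : Type} [Field 𝕜] [DecidableEq m]
    {b : n → Matrix m m 𝕜} (hb : IsTraceOrthogonal b)
    (hspan : Submodule.span 𝕜 (Set.range b) = (LieAlgebra.SpecialLinear.sl m 𝕜).toSubmodule)
    {T : Set n} {i j : n} (h : ∀ k, k ∈ T ∨ (⁅b i, b j⁆ * (b k)ᵀ).trace = 0) :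
    ⁅b i, b j⁆ ∈ Submodule.span 𝕜 (b '' T) := by
  refine hb.mem_span_image ?_ h
  rw [hspan]
  exact mem_sl_iff.2 (by rw [Ring.lie_def, trace_sub, trace_mul_comm, sub_self])

end TraceOrthogonal

/-! ### Homogeneous bases with one component that is not a line -/

section Weights

variable {𝕜 A : Type} [Field 𝕜] [LieRing A] [LieAlgebra 𝕜 A]
variable {ι n : Type} {Γ : ι → Submodule 𝕜 A} {b : n → A} {κ : n → ι}

theorem isHomogeneousBasis_of_lines {Γ : n → Submodule 𝕜 A} (hb : LinearIndependent 𝕜 b)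
    (hline : ∀ i, Γ i = Submodule.span 𝕜 {b i}) : IsHomogeneousBasis Γ b id :=
  ⟨hb, fun k => by rw [hline, Set.preimage_id, Set.image_singleton], Function.surjective_id⟩

theorem isHomogeneousBasis_of_lines_of_notMem (hb : LinearIndependent 𝕜 b)
    (hκ : Function.Surjective κ) {k₀ : ι} {J : Finset n} (hJ : ∀ i, κ i = k₀ ↔ i ∈ J)
    (hinj : ∀ i, i ∉ J → ∀ j, κ j = κ i → j = i)
    (hline : ∀ i, i ∉ J → Γ (κ i) = Submodule.span 𝕜 {b i})
    (hΓ : Γ k₀ = Submodule.span 𝕜 (b '' J)) : IsHomogeneousBasis Γ b κ := by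
  refine ⟨hb, fun k => ?_, hκ⟩
  obtain ⟨i, rfl⟩ := hκ k
  by_cases hi : i ∈ J
  · have hpre : κ ⁻¹' {k₀} = J := Set.ext hJ
    rw [(hJ i).2 hi, hΓ, hpre]
  · have hpre : κ ⁻¹' {κ i} = {i} :=
      Set.ext fun j => ⟨hinj i hi j, fun h => congrArg κ h⟩
    rw [hline i hi, hpre, Set.image_singleton]

theorem IsHomogeneousBasis.isUnsplittable (h : IsHomogeneousBasis Γ b κ) {k₀ : ι}
    (hline : ∀ i, κ i ≠ k₀ → ∀ j, κ j = κ i → j = i) (h₀ : IsUnsplittable Γ k₀) (k : ι) :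
    IsUnsplittable Γ k := by
  by_cases hk : k = k₀
  · rwa [hk]
  · obtain ⟨i, rfl⟩ := h.surjective k
    exact Or.inl (h.isAtom (hline i hk))

/-- The elements `b (J a)` span the component of index `k`, and `ad (b (J a))` maps the line
through `b (l t)` to the line through `b (m t)` by the scalar `w t a`. -/
structure IsWeightTable {σ τ : Type} {B : Type} [LieRing B] (b : n → B) (κ : n → ι) (k : ι)
    (J : σ → n) (l m : τ → n) (w : τ → σ → ℤ) : Prop where
  eq_iff : ∀ i, κ i = k ↔ ∃ a, J a = i
  line_left : ∀ t j, κ j = κ (l t) → j = l t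
  line_right : ∀ t j, κ j = κ (m t) → j = m t
  lie_eq : ∀ a t, ⁅b (J a), b (l t)⁆ = w t a • b (m t)

namespace IsWeightTable

variable {σ τ : Type} {k : ι} {J : σ → n} {l m : τ → n} {w : τ → σ → ℤ}

theorem eq_span_range (hw : IsWeightTable b κ k J l m w) (h : IsHomogeneousBasis Γ b κ) :
    Γ k = Submodule.span 𝕜 (Set.range fun a => b (J a)) := by
  have hpre : κ ⁻¹' {k} = Set.range J := Set.ext hw.eq_iff
  rw [h.eq_span, hpre, ← Set.range_comp]
  rfl

variable [Fintype σ]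

theorem lie_sum_smul (hw : IsWeightTable b κ k J l m w) (α : σ → 𝕜) (t : τ) :
    ⁅∑ a, α a • b (J a), b (l t)⁆ = (∑ a, α a * w t a) • b (m t) := by
  simp only [sum_lie, smul_lie, hw.lie_eq, Finset.sum_smul, mul_smul, Int.cast_smul_eq_zsmul]

theorem moves (hw : IsWeightTable b κ k J l m w) (h : IsHomogeneousBasis Γ b κ) {α : σ → 𝕜} {t : τ}
    (ht : ∑ a, α a * w t a ≠ 0) : Moves Γ (∑ a, α a • b (J a)) (κ (l t)) (κ (m t)) := by
  refine ⟨h.isAtom (hw.line_left t), h.isAtom (hw.line_right t), ⟨b (l t), h.mem (l t), ?_⟩, ?_⟩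
  · rw [hw.lie_sum_smul]
    exact smul_ne_zero ht (h.linearIndependent.ne_zero (m t))
  · intro x hx
    rw [h.eq_span_singleton (hw.line_left t)] at hx
    obtain ⟨c, rfl⟩ := Submodule.mem_span_singleton.1 hx
    rw [lie_smul, hw.lie_sum_smul]
    exact Submodule.smul_mem _ _ (Submodule.smul_mem _ _ (h.mem (m t)))

theorem exists_moves (hw : IsWeightTable b κ k J l m w) (h : IsHomogeneousBasis Γ b κ) {u : A}
    (hu : u ∈ Γ k) (hu0 : u ≠ 0) :
    ∃ α : σ → 𝕜, α ≠ 0 ∧ ∀ t, ∑ a, α a * w t a ≠ 0 → Moves Γ u (κ (l t)) (κ (m t)) := by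
  rw [hw.eq_span_range h] at hu
  obtain ⟨α, rfl⟩ := (Submodule.mem_span_range_iff_exists_fun 𝕜).1 hu
  refine ⟨α, ?_, fun t => hw.moves h⟩
  rintro rfl
  simp only [Pi.zero_apply, zero_smul, Finset.sum_const_zero, ne_eq, not_true] at hu0

theorem isUnsplittable (hw : IsWeightTable b κ k J l m w) (h : IsHomogeneousBasis Γ b κ)
    (hsep : ∀ α β : σ → 𝕜, (∀ t, ∑ a, α a * w t a = 0 ∨ ∑ a, β a * w t a = 0) → α = 0 ∨ β = 0) :
    IsUnsplittable Γ k := by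
  refine Or.inr fun u hu v hv hu0 hv0 => Or.inl ?_
  obtain ⟨α, hα, hαm⟩ := hw.exists_moves h hu hu0
  obtain ⟨β, hβ, hβm⟩ := hw.exists_moves h hv hv0
  have hne : ¬ ∀ t, ∑ a, α a * w t a = 0 ∨ ∑ a, β a * w t a = 0 :=
    fun ht => (hsep α β ht).elim hα hβ
  push Not at hne
  obtain ⟨t, htα, htβ⟩ := hne
  exact ⟨_, _, hαm t htα, hβm t htβ⟩

theorem exists_moves_self {w : τ → σ → ℤ} (hw : IsWeightTable b κ k J l l w)
    (h : IsHomogeneousBasis Γ b κ)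
    (hsep : ∀ α : σ → 𝕜, (∀ t, ∑ a, α a * w t a = 0) → α = 0) {u : A} (hu : u ∈ Γ k)
    (hu0 : u ≠ 0) : ∃ t, Moves Γ u (κ (l t)) (κ (l t)) := by
  obtain ⟨α, hα, hαm⟩ := hw.exists_moves h hu hu0
  have hne := mt (hsep α) hα
  push Not at hne
  obtain ⟨t, ht⟩ := hne
  exact ⟨t, hαm t ht⟩

end IsWeightTable

theorem isUnsplittable_of_exists_moves_self {k : ι}
    (h : ∀ u ∈ Γ k, u ≠ 0 → ∃ l, Moves Γ u l l) : IsUnsplittable Γ k := by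
  refine Or.inr fun u hu v hv hu0 hv0 => Or.inr ?_
  obtain ⟨l, hl⟩ := h u hu hu0
  obtain ⟨m, hm⟩ := h v hv hv0
  exact ⟨l, m, hl, hm⟩

end Weights

/-! ### Subalgebras displayed by a grading -/

section Display

theorem trace_eq_zero_of_mem_oAlg {K : M4} (hK : K * K = 1) {X : M4} (hX : X ∈ oAlg K) :
    X.trace = 0 := by
  have hXK : X * K = -(K * Xᵀ) := hX
  have htr : X.trace = -X.trace :=
    calc X.trace = (X * K * K).trace := by rw [Matrix.mul_assoc, hK, Matrix.mul_one]
      _ = -(K * K * Xᵀ).trace := by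
        rw [hXK, neg_mul, trace_neg, trace_mul_comm, ← Matrix.mul_assoc]
      _ = -X.trace := by rw [hK, Matrix.one_mul, trace_transpose]
  exact self_eq_neg.1 htr

theorem mul_eq_mul_transpose_of_mem_span {K : M4} {s : Set M4} (hs : ∀ X ∈ s, X * K = K * Xᵀ)
    {X : M4} (hX : X ∈ Submodule.span ℂ s) : X * K = K * Xᵀ := by
  induction hX using Submodule.span_induction with
  | mem X hX => exact hs X hX
  | zero => rw [Matrix.zero_mul, transpose_zero, Matrix.mul_zero]
  | add X Y _ _ hX hY => rw [add_mul, hX, hY, transpose_add, mul_add]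
  | smul c X _ hX => rw [smul_mul_assoc, hX, transpose_smul, mul_smul_comm]

theorem eq_zero_of_mem_oAlg_of_mul_eq {K : M4} (hK : K * K = 1) {X : M4} (hX : X ∈ oAlg K)
    (hself : X * K = K * Xᵀ) : X = 0 := by
  have hskew : X * K = -(K * Xᵀ) := hX
  rw [← hself] at hskew
  have hXK : X * K = 0 := Matrix.ext fun i j => self_eq_neg.1 (congrFun (congrFun hskew i) j)
  rw [← Matrix.mul_one X, ← hK, ← Matrix.mul_assoc, hXK, Matrix.zero_mul]

theorem oAlg_eq_span {n : Type} {K : M4} (hK : K * K = 1) {b : n → M4}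
    (hb : Submodule.span ℂ (Set.range b) = sl4.toSubmodule) {T : Set n}
    (hskew : ∀ i ∈ T, b i * K = -(K * (b i)ᵀ)) (hself : ∀ i, i ∉ T → b i * K = K * (b i)ᵀ) :
    (oAlg K).toSubmodule = Submodule.span ℂ (b '' T) := by
  have hle : Submodule.span ℂ (b '' T) ≤ (oAlg K).toSubmodule :=
    Submodule.span_le.2 (Set.forall_mem_image.2 hskew)
  refine le_antisymm (fun X hX => ?_) hle
  have hXb : X ∈ Submodule.span ℂ (b '' T) ⊔ Submodule.span ℂ (b '' Tᶜ) := by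
    rw [← Submodule.span_union, ← Set.image_union, Set.union_compl_self, Set.image_univ, hb]
    exact mem_sl_iff.2 (trace_eq_zero_of_mem_oAlg hK hX)
  obtain ⟨Y, hY, Z, hZ, rfl⟩ := Submodule.mem_sup.1 hXb
  have hZo : Z ∈ oAlg K := by
    have := sub_mem hX (hle hY)
    rwa [add_sub_cancel_left] at this
  have hZ0 := eq_zero_of_mem_oAlg_of_mul_eq hK hZo
    (mul_eq_mul_transpose_of_mem_span (Set.forall_mem_image.2 hself) hZ)
  rwa [hZ0, add_zero]

variable {ι : Type} {Γ : ι → Submodule ℂ M4} {S : Set ι} {K : M4} {P : LieSubalgebra ℝ M4}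

theorem realPart_oInter {k : ι} (hk : Γ k ≤ (oAlg K).toSubmodule) :
    realPart Γ (oInter K P) k = realPart Γ P k :=
  le_antisymm (fun _ hx => ⟨hx.1, hx.2.2⟩) fun _ hx => ⟨hx.1, hk hx.1, hx.2⟩

/-- The group grading `Γ` of `sl(4, ℂ)` and its part with index in `S`, which is a grading of
`o_K(4, ℂ)`, are fine: the complex half of the notion of display. -/
structure IsComplexDisplay (Γ : ι → Submodule ℂ M4) (S : Set ι) (K : M4) : Prop where
  isAbelianGroupGrading : IsAbelianGroupGrading sl4 Γ
  isUnsplittable : ∀ k, IsUnsplittable Γ k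
  isUnsplittable_restrict : ∀ k : S, IsUnsplittable (fun k : S => Γ k) k
  nonempty : S.Nonempty
  symm : Kᵀ = K
  mul_self : K * K = 1
  oAlg_eq : (oAlg K).toSubmodule = ⨆ k : S, Γ k

namespace IsComplexDisplay

theorem le_oAlg (h : IsComplexDisplay Γ S K) (k : S) : Γ k ≤ (oAlg K).toSubmodule :=
  h.oAlg_eq ▸ le_iSup (fun k : S => Γ k) k

theorem realPart_oInter (h : IsComplexDisplay Γ S K) :
    realPart (fun k : S => Γ k) (oInter K P) = fun k : S => realPart Γ P k :=
  funext fun k => FineGradings.realPart_oInter (Γ := fun k : S => Γ k) (h.le_oAlg k)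

theorem isSpannedBy_oInter (h : IsComplexDisplay Γ S K) (hΓ : IsSpannedBy Γ P) :
    IsSpannedBy (fun k : S => Γ k) (oInter K P) := by
  intro k
  rw [h.realPart_oInter]
  exact hΓ k

theorem isFineGroupGrading (h : IsComplexDisplay Γ S K) : IsFineGroupGrading sl4 Γ :=
  h.isAbelianGroupGrading.isFineGroupGrading h.isUnsplittable

theorem determines (h : IsComplexDisplay Γ S K) (hP : IsTotallyReal P.toSubmodule)
    (hsl : ∀ x ∈ P, x ∈ sl4) (hΓ : IsSpannedBy Γ P) : Determines Γ P where
  fine_complex := h.isFineGroupGrading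
  realForm := hΓ.isRealForm hP h.isAbelianGroupGrading.1.iSup_eq hsl
  span_eq := hΓ
  fine_real := (hΓ.isAbelianGroupGrading hP h.isAbelianGroupGrading hsl).isFineGroupGrading
    fun k => hΓ.isUnsplittable_realPart hP (h.isUnsplittable k)

theorem det_ne_zero (h : IsComplexDisplay Γ S K) : K.det ≠ 0 :=
  Matrix.det_ne_zero_of_right_inverse h.mul_self

theorem displays (h : IsComplexDisplay Γ S K) (hP : IsTotallyReal P.toSubmodule)
    (hsl : ∀ x ∈ P, x ∈ sl4) (hΓ : IsSpannedBy Γ P) {R : Type} [LieRing R] [LieAlgebra ℝ R]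
    (hR : Nonempty (oInter K P ≃ₗ⁅ℝ⁆ R)) : Displays Γ S K P R := by
  have hPo : IsTotallyReal (oInter K P).toSubmodule := hP.mono fun x hx => hx.2
  have hle (x : M4) (hx : x ∈ oInter K P) : x ∈ oAlg K := hx.1
  have hΓo := h.isSpannedBy_oInter hΓ
  have hgr := hΓo.isAbelianGroupGrading hPo
    (h.isAbelianGroupGrading.restrict h.nonempty h.oAlg_eq) hle
  have hfine := hgr.isFineGroupGrading fun k =>
    hΓo.isUnsplittable_realPart hPo (h.isUnsplittable_restrict k)
  have hsum := hgr.1.iSup_eq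
  rw [h.realPart_oInter] at hfine hsum
  exact ⟨h.determines hP hsl hΓ, h.symm, h.det_ne_zero, hΓo.isRealForm hPo h.oAlg_eq.symm hle, hR,
    h.oAlg_eq, hsum.symm, hfine⟩

end IsComplexDisplay

end Display

/-! ### Gradings with an integral basis -/

section Integral

theorem IsHomogeneousBasis.isUnsplittable_restrict {𝕜 A : Type} [Field 𝕜] [LieRing A]
    [LieAlgebra 𝕜 A] {ι n : Type} {Γ : ι → Submodule 𝕜 A} {b : n → A} {κ : n → ι}
    (h : IsHomogeneousBasis Γ b κ) {S : Set ι} (hline : ∀ i, κ i ∈ S → ∀ j, κ j = κ i → j = i)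
    (k : S) : IsUnsplittable (fun k : S => Γ k) k := by
  obtain ⟨k, hk⟩ := k
  obtain ⟨i, rfl⟩ := h.surjective k
  exact Or.inl (h.isAtom (hline i hk))

/-- The complex matrix with the given integral entries. -/
def ofInt : Matrix (Fin 4) (Fin 4) ℤ →+* M4 := (Int.castRingHom ℂ).mapMatrix

theorem ofInt_transpose (X : Matrix (Fin 4) (Fin 4) ℤ) : ofInt Xᵀ = (ofInt X)ᵀ := rfl

theorem trace_ofInt (X : Matrix (Fin 4) (Fin 4) ℤ) : (ofInt X).trace = X.trace :=
  (AddMonoidHom.map_trace (Int.castRingHom ℂ) X).symm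

theorem ofInt_lie (X Y : Matrix (Fin 4) (Fin 4) ℤ) : ofInt ⁅X, Y⁆ = ⁅ofInt X, ofInt Y⁆ := by
  simp only [Ring.lie_def, map_sub, map_mul]

/-- The integral matrix unit `E_{jk}`, with `j, k ∈ {1, 2, 3, 4}`. -/
def eInt (j k : ℕ) : Matrix (Fin 4) (Fin 4) ℤ :=
  Matrix.of fun a b => if a.val + 1 = j ∧ b.val + 1 = k then 1 else 0

theorem ofInt_eInt (j k : ℕ) : ofInt (eInt j k) = e j k := by
  ext a b
  exact (apply_ite (Int.cast : ℤ → ℂ) _ 1 0).trans (by rw [Int.cast_one, Int.cast_zero]; rfl)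

instance {R n m : Type} [CommRing R] [DecidableEq R] [Fintype m] [Fintype n] [DecidableEq n]
    (b : n → Matrix m m R) : Decidable (IsTraceOrthogonal b) :=
  inferInstanceAs (Decidable (∀ i j, (b i * (b j)ᵀ).trace = 0 ↔ i ≠ j))

variable {ι G : Type} [AddCommGroup G] {b : Fin 15 → Matrix (Fin 4) (Fin 4) ℤ} {κ : Fin 15 → ι}

/-- A trace-orthogonal integral basis `b` of `sl(4)` is graded by the degrees `d (κ i)`, and it
consists of skew-adjoint and self-adjoint matrices for the involutive symmetric matrix `K`, those
of the components with index in `Q` being skew-adjoint. All this is decidable. -/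
structure IsIntegralDisplay (b : Fin 15 → Matrix (Fin 4) (Fin 4) ℤ) (κ : Fin 15 → ι) (d : ι → G)
    (Q : Finset ι) (K : Matrix (Fin 4) (Fin 4) ℤ) : Prop where
  isTraceOrthogonal : IsTraceOrthogonal b
  trace_eq_zero : ∀ i, (b i).trace = 0
  injective : Function.Injective d
  trace_lie_mul_transpose : ∀ i j m,
    d (κ m) = d (κ i) + d (κ j) ∨ (⁅b i, b j⁆ * (b m)ᵀ).trace = 0
  nonempty : Q.Nonempty
  symm : Kᵀ = K
  mul_self : K * K = 1
  skew : ∀ i, κ i ∈ Q → b i * K = -(K * (b i)ᵀ)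
  self : ∀ i, κ i ∉ Q → b i * K = K * (b i)ᵀ

theorem IsTraceOrthogonal.ofInt (hb : IsTraceOrthogonal b) :
    IsTraceOrthogonal fun i => ofInt (b i) :=
  hb.map Int.cast_injective

namespace IsIntegralDisplay

variable {d : ι → G} {Q : Finset ι} {K : Matrix (Fin 4) (Fin 4) ℤ}

theorem linearIndependent (h : IsIntegralDisplay b κ d Q K) :
    LinearIndependent ℂ fun i => ofInt (b i) :=
  h.isTraceOrthogonal.ofInt.linearIndependent

theorem span_range (h : IsIntegralDisplay b κ d Q K) :
    Submodule.span ℂ (Set.range fun i => ofInt (b i)) = sl4.toSubmodule :=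
  h.isTraceOrthogonal.ofInt.span_range_eq_sl
    (fun i => by rw [trace_ofInt, h.trace_eq_zero, Int.cast_zero]) (by simp only [Fintype.card_fin])

theorem lie_mem_span (h : IsIntegralDisplay b κ d Q K) (i j : Fin 15) :
    ⁅ofInt (b i), ofInt (b j)⁆ ∈
      Submodule.span ℂ ((fun i => ofInt (b i)) '' {m | d (κ m) = d (κ i) + d (κ j)}) := by
  refine h.isTraceOrthogonal.ofInt.lie_mem_span h.span_range fun m => ?_
  refine (h.trace_lie_mul_transpose i j m).imp_right fun htr => ?_
  rw [← ofInt_lie, ← ofInt_transpose, ← map_mul, trace_ofInt, htr, Int.cast_zero]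

variable {Γ : ι → Submodule ℂ M4} {S : Set ι} {K' : M4}

theorem oAlg_eq (h : IsIntegralDisplay b κ d Q K)
    (hΓ : IsHomogeneousBasis Γ (fun i => ofInt (b i)) κ) :
    (oAlg (ofInt K)).toSubmodule = ⨆ k : (Q : Set ι), Γ k := by
  rw [hΓ.iSup_subtype]
  refine oAlg_eq_span (by rw [← map_mul, h.mul_self, map_one]) h.span_range
    (fun i hi => ?_) fun i hi => ?_
  · rw [← map_mul, h.skew i hi, map_neg, map_mul, ofInt_transpose]
  · rw [← map_mul, h.self i hi, map_mul, ofInt_transpose]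

theorem isComplexDisplay (h : IsIntegralDisplay b κ d Q K)
    (hΓ : IsHomogeneousBasis Γ (fun i => ofInt (b i)) κ) (hu : ∀ k, IsUnsplittable Γ k)
    (hur : ∀ k : S, IsUnsplittable (fun k : S => Γ k) k) (hS : S = Q) (hK : K' = ofInt K) :
    IsComplexDisplay Γ S K' := by
  subst hS hK
  obtain ⟨k, hk⟩ := h.nonempty
  have : Nonempty ι := ⟨k⟩
  refine ⟨hΓ.isAbelianGroupGrading h.span_range h.injective h.lie_mem_span, hu, hur, ⟨k, hk⟩, ?_,
    ?_, h.oAlg_eq hΓ⟩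
  · rw [← ofInt_transpose, h.symm]
  · rw [← map_mul, h.mul_self, map_one]

end IsIntegralDisplay

theorem IsWeightTable.ofInt {σ τ : Type} {k : ι} {J : σ → Fin 15} {l m : τ → Fin 15}
    {w : τ → σ → ℤ} (hw : IsWeightTable b κ k J l m w) :
    IsWeightTable (fun i => ofInt (b i)) κ k J l m w where
  eq_iff := hw.eq_iff
  line_left := hw.line_left
  line_right := hw.line_right
  lie_eq a t := by rw [← ofInt_lie, hw.lie_eq, map_zsmul]

end Integral

/-! ### The gradings `Γ₃, …, Γ₈` -/

section Concrete

/-- The integral matrix with the entries of `K₂`. -/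
def kInt₂ : Matrix (Fin 4) (Fin 4) ℤ := !![1, 0, 0, 0; 0, 1, 0, 0; 0, 0, 0, 1; 0, 0, 1, 0]

/-- The integral matrix with the entries of `K₃`. -/
def kInt₃ : Matrix (Fin 4) (Fin 4) ℤ := !![0, 1, 0, 0; 1, 0, 0, 0; 0, 0, 0, 1; 0, 0, 1, 0]

theorem K₁_eq_ofInt : K₁ = ofInt 1 := (map_one ofInt).symm

theorem K₂_eq_ofInt : K₂ = ofInt kInt₂ := by
  ext i j
  fin_cases i <;> fin_cases j <;> simp [ofInt, K₂, kInt₂]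

theorem K₃_eq_ofInt : K₃ = ofInt kInt₃ := by
  ext i j
  fin_cases i <;> fin_cases j <;> simp [ofInt, K₃, kInt₃]

/-- The distribution of a basis over thirteen components, the last of which has dimension three. -/
def κ₁₃ : Fin 15 → Fin 13 := ![0, 1, 2, 3, 4, 5, 6, 7, 8, 9, 10, 11, 12, 12, 12]

/-- The distribution of a basis over fourteen components, the last of which has dimension two. -/
def κ₁₄ : Fin 15 → Fin 14 := ![0, 1, 2, 3, 4, 5, 6, 7, 8, 9, 10, 11, 12, 13, 13]

/-- A basis of `sl(4, ℂ)` that is homogeneous for `Γ₃`. -/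
def b₃ : Fin 15 → Matrix (Fin 4) (Fin 4) ℤ :=
  ![eInt 1 4 + eInt 4 1, eInt 1 4 - eInt 4 1, eInt 2 4 + eInt 4 2, eInt 2 4 - eInt 4 2,
    eInt 3 4 + eInt 4 3, eInt 3 4 - eInt 4 3, eInt 1 3 + eInt 3 1, eInt 1 3 - eInt 3 1,
    eInt 2 3 + eInt 3 2, eInt 2 3 - eInt 3 2, eInt 1 2 + eInt 2 1, eInt 1 2 - eInt 2 1,
    eInt 1 1 - eInt 2 2, eInt 3 3 - eInt 4 4, eInt 1 1 + eInt 2 2 - eInt 3 3 - eInt 4 4]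

/-- The degrees that make `Γ₃` a group grading. -/
def d₃ (k : Fin 13) : ZMod 2 × ZMod 2 × ZMod 2 × ZMod 2 :=
  (![1, 0, 1, 0, 1, 0, 1, 0, 1, 0, 1, 0, 1] k,
    ![1, 1, 1, 1, 1, 1, 0, 0, 0, 0, 0, 0, 0] k,
    ![0, 0, 0, 0, 1, 1, 1, 1, 1, 1, 0, 0, 0] k,
    ![0, 0, 1, 1, 0, 0, 0, 0, 1, 1, 1, 1, 0] k)

theorem isIntegralDisplay₃ :
    IsIntegralDisplay b₃ κ₁₃ d₃ {1, 3, 5, 7, 9, 11} 1 := by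
  constructor <;> decide +kernel

theorem span_diagonal_differences :
    sp {e 1 1 - e 2 2, e 2 2 - e 3 3, e 3 3 - e 4 4} =
      sp {e 1 1 - e 2 2, e 3 3 - e 4 4, e 1 1 + e 2 2 - e 3 3 - e 4 4} := by
  refine le_antisymm (Submodule.span_le.2 ?_) (Submodule.span_le.2 ?_)
  · rintro _ (rfl | rfl | rfl)
    · exact Submodule.mem_span_of_mem (by simp)
    · exact Submodule.mem_span_triple.2 ⟨-1 / 2, -1 / 2, 1 / 2, by module⟩
    · exact Submodule.mem_span_of_mem (by simp)
  · rintro _ (rfl | rfl | rfl)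
    · exact Submodule.mem_span_of_mem (by simp)
    · exact Submodule.mem_span_of_mem (by simp)
    · exact Submodule.mem_span_triple.2 ⟨1, 2, 1, by module⟩

theorem isHomogeneousBasis₃ : IsHomogeneousBasis Γ₃ (fun i => ofInt (b₃ i)) κ₁₃ := by
  refine isHomogeneousBasis_of_lines_of_notMem isIntegralDisplay₃.linearIndependent (k₀ := 12)
    (J := {12, 13, 14}) (by decide) (by decide) (by decide) (fun i hi => ?_) ?_
  · fin_cases i <;> first | exact absurd (by decide) hi | simp [Γ₃, κ₁₃, b₃, ofInt_eInt]
  · simpa [Γ₃, b₃, Set.image_insert_eq, ofInt_eInt] using span_diagonal_differences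

theorem isWeightTable₃ :
    IsWeightTable b₃ κ₁₃ 12 ![12, 13, 14] ![0, 2, 4, 6, 8, 10] ![1, 3, 5, 7, 9, 11]
      ![![1, 1, 2], ![-1, 1, 2], ![0, 2, 0], ![1, -1, 2], ![-1, -1, 2], ![2, 0, 0]] := by
  constructor <;> decide +kernel

theorem isUnsplittable₃ (k : Fin 13) : IsUnsplittable Γ₃ k := by
  refine isHomogeneousBasis₃.isUnsplittable (k₀ := 12) (by decide) ?_ k
  refine isWeightTable₃.ofInt.isUnsplittable isHomogeneousBasis₃ fun α β h => ?_
  have roots : (α 0 + α 1 + α 2 * 2 = 0 ∨ β 0 + β 1 + β 2 * 2 = 0) ∧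
      (-α 0 + α 1 + α 2 * 2 = 0 ∨ -β 0 + β 1 + β 2 * 2 = 0) ∧
      (α 1 = 0 ∨ β 1 = 0) ∧
      (α 0 + -α 1 + α 2 * 2 = 0 ∨ β 0 + -β 1 + β 2 * 2 = 0) ∧
      (-α 0 + -α 1 + α 2 * 2 = 0 ∨ -β 0 + -β 1 + β 2 * 2 = 0) ∧
      (α 0 = 0 ∨ β 0 = 0) := by
    simpa [Fin.forall_fin_succ, Fin.sum_univ_three] using h
  have : (α 0 = 0 ∧ α 1 = 0 ∧ α 2 = 0) ∨ (β 0 = 0 ∧ β 1 = 0 ∧ β 2 = 0) := by grind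
  simpa [funext_iff, Fin.forall_fin_succ] using this

theorem isComplexDisplay₃ : IsComplexDisplay Γ₃ S₃ K₁ := by
  refine isIntegralDisplay₃.isComplexDisplay isHomogeneousBasis₃ isUnsplittable₃
    (isHomogeneousBasis₃.isUnsplittable_restrict ?_) (by simp [S₃]) K₁_eq_ofInt
  simp only [S₃, Set.mem_insert_iff, Set.mem_singleton_iff]
  decide

/-- A basis of `sl(4, ℂ)` that is homogeneous for `Γ₄`. -/
def b₄ : Fin 15 → Matrix (Fin 4) (Fin 4) ℤ :=
  ![eInt 1 3 - eInt 4 1, eInt 1 3 + eInt 4 1, eInt 1 4 - eInt 3 1, eInt 1 4 + eInt 3 1,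
    eInt 2 4 - eInt 3 2, eInt 2 4 + eInt 3 2, eInt 2 3 - eInt 4 2, eInt 2 3 + eInt 4 2,
    eInt 1 2 - eInt 2 1, eInt 1 2 + eInt 2 1, eInt 3 4, eInt 4 3, eInt 3 3 - eInt 4 4,
    eInt 1 1 - eInt 2 2, eInt 1 1 + eInt 2 2 - eInt 3 3 - eInt 4 4]

/-- The degrees that make `Γ₄` a group grading. -/
def d₄ (k : Fin 14) : ℤ × ZMod 2 × ZMod 2 :=
  (![-1, -1, 1, 1, 1, 1, -1, -1, 0, 0, 2, -2, 0, 0] k,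
    ![0, 1, 0, 1, 0, 1, 0, 1, 0, 1, 1, 1, 0, 1] k,
    ![0, 0, 0, 0, 1, 1, 1, 1, 1, 1, 0, 0, 0, 0] k)

theorem isIntegralDisplay₄ :
    IsIntegralDisplay b₄ κ₁₄ d₄ {12, 0, 4, 8, 6, 2} kInt₂ := by
  constructor <;> decide +kernel

theorem isHomogeneousBasis₄ : IsHomogeneousBasis Γ₄ (fun i => ofInt (b₄ i)) κ₁₄ := by
  refine isHomogeneousBasis_of_lines_of_notMem isIntegralDisplay₄.linearIndependent (k₀ := 13)
    (J := {13, 14}) (by decide) (by decide) (by decide) (fun i hi => ?_) ?_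
  · fin_cases i <;> first | exact absurd (by decide) hi | simp [Γ₄, κ₁₄, b₄, ofInt_eInt]
  · simp [Γ₄, b₄, Set.image_insert_eq, ofInt_eInt]

theorem isWeightTable₄ :
    IsWeightTable b₄ κ₁₄ 13 ![13, 14] ![0, 4, 8] ![1, 5, 9]
      ![![1, 2], ![-1, 2], ![2, 0]] := by
  constructor <;> decide +kernel

theorem isUnsplittable₄ (k : Fin 14) : IsUnsplittable Γ₄ k := by
  refine isHomogeneousBasis₄.isUnsplittable (k₀ := 13) (by decide) ?_ k
  refine isWeightTable₄.ofInt.isUnsplittable isHomogeneousBasis₄ fun α β h => ?_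
  have roots : (α 0 + α 1 * 2 = 0 ∨ β 0 + β 1 * 2 = 0) ∧
      (-α 0 + α 1 * 2 = 0 ∨ -β 0 + β 1 * 2 = 0) ∧
      (α 0 = 0 ∨ β 0 = 0) := by
    simpa [Fin.forall_fin_succ, Fin.sum_univ_two] using h
  have : (α 0 = 0 ∧ α 1 = 0) ∨ (β 0 = 0 ∧ β 1 = 0) := by grind
  simpa [funext_iff, Fin.forall_fin_succ] using this

theorem isComplexDisplay₄ : IsComplexDisplay Γ₄ S₄ K₂ := by
  refine isIntegralDisplay₄.isComplexDisplay isHomogeneousBasis₄ isUnsplittable₄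
    (isHomogeneousBasis₄.isUnsplittable_restrict ?_) (by simp [S₄]) K₂_eq_ofInt
  simp only [S₄, Set.mem_insert_iff, Set.mem_singleton_iff]
  decide

/-- A basis of `sl(4, ℂ)` that is homogeneous for `Γ₅`. -/
def b₅ : Fin 15 → Matrix (Fin 4) (Fin 4) ℤ :=
  ![eInt 2 3 - eInt 4 1, eInt 2 3 + eInt 4 1, eInt 2 4 - eInt 3 1, eInt 2 4 + eInt 3 1,
    eInt 1 3 - eInt 4 2, eInt 1 3 + eInt 4 2, eInt 1 4 - eInt 3 2, eInt 1 4 + eInt 3 2, eInt 1 2,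
    eInt 2 1, eInt 3 4, eInt 4 3, eInt 1 1 + eInt 2 2 - eInt 3 3 - eInt 4 4,
    eInt 1 1 - eInt 2 2 + eInt 3 3 - eInt 4 4, eInt 1 1 - eInt 2 2 - eInt 3 3 + eInt 4 4]

/-- The degrees that make `Γ₅` a group grading. -/
def d₅ (k : Fin 14) : ZMod 4 × ZMod 4 :=
  (![3, 3, 1, 1, 3, 3, 1, 1, 0, 0, 2, 2, 0, 0] k,
    ![1, 3, 0, 2, 0, 2, 3, 1, 1, 3, 1, 3, 2, 0] k)

theorem isIntegralDisplay₅ :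
    IsIntegralDisplay b₅ κ₁₄ d₅ {13, 0, 2, 4, 6} kInt₃ := by
  constructor <;> decide +kernel

theorem isHomogeneousBasis₅ : IsHomogeneousBasis Γ₅ (fun i => ofInt (b₅ i)) κ₁₄ := by
  refine isHomogeneousBasis_of_lines_of_notMem isIntegralDisplay₅.linearIndependent (k₀ := 13)
    (J := {13, 14}) (by decide) (by decide) (by decide) (fun i hi => ?_) ?_
  · fin_cases i <;> first | exact absurd (by decide) hi | simp [Γ₅, κ₁₄, b₅, ofInt_eInt]
  · simp [Γ₅, b₅, Set.image_insert_eq, ofInt_eInt]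

theorem isWeightTable₅ :
    IsWeightTable b₅ κ₁₄ 13 ![13, 14] ![0, 2] ![0, 2]
      ![![-2, 0], ![0, -2]] := by
  constructor <;> decide +kernel

theorem exists_moves_self₅ {u : M4} (hu : u ∈ Γ₅ 13) (hu0 : u ≠ 0) :
    Moves Γ₅ u 0 0 ∨ Moves Γ₅ u 2 2 := by
  refine Fin.exists_fin_two.1 (isWeightTable₅.ofInt.exists_moves_self isHomogeneousBasis₅
    (fun α h => ?_) hu hu0)
  simpa [funext_iff, Fin.forall_fin_succ, Fin.sum_univ_two] using h

theorem isUnsplittable₅ (k : Fin 14) : IsUnsplittable Γ₅ k := by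
  refine isHomogeneousBasis₅.isUnsplittable (k₀ := 13) (by decide) ?_ k
  exact isUnsplittable_of_exists_moves_self fun u hu hu0 =>
    (exists_moves_self₅ hu hu0).elim (fun h => ⟨_, h⟩) fun h => ⟨_, h⟩

theorem isUnsplittable_restrict₅ (k : S₅) : IsUnsplittable (fun k : S₅ => Γ₅ k) k := by
  obtain ⟨k, hk⟩ := k
  obtain ⟨i, rfl⟩ := isHomogeneousBasis₅.surjective k
  by_cases hi : κ₁₄ i = 13
  · refine isUnsplittable_of_exists_moves_self fun u hu hu0 => ?_
    rcases exists_moves_self₅ (hi ▸ hu) hu0 with h | h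
    · exact ⟨⟨0, by simp [S₅]⟩, h.1, h.2, h.3, h.4⟩
    · exact ⟨⟨2, by simp [S₅]⟩, h.1, h.2, h.3, h.4⟩
  · have hline : ∀ i, κ₁₄ i ≠ 13 → ∀ j, κ₁₄ j = κ₁₄ i → j = i := by decide
    exact Or.inl (isHomogeneousBasis₅.isAtom (hline i hi))

theorem isComplexDisplay₅ : IsComplexDisplay Γ₅ S₅ K₃ :=
  isIntegralDisplay₅.isComplexDisplay isHomogeneousBasis₅ isUnsplittable₅ isUnsplittable_restrict₅
    (by simp [S₅]) K₃_eq_ofInt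

/-- A basis of `sl(4, ℂ)` that is homogeneous for `Γ₆`. -/
def b₆ : Fin 15 → Matrix (Fin 4) (Fin 4) ℤ :=
  ![eInt 1 1 - eInt 2 2 + eInt 3 3 - eInt 4 4, eInt 1 1 - eInt 2 2 - eInt 3 3 + eInt 4 4,
    eInt 1 1 + eInt 2 2 - eInt 3 3 - eInt 4 4, eInt 1 3 - eInt 2 4 + eInt 3 1 - eInt 4 2,
    eInt 1 3 + eInt 2 4 - eInt 3 1 - eInt 4 2, eInt 1 3 + eInt 2 4 + eInt 3 1 + eInt 4 2,
    eInt 1 3 - eInt 2 4 - eInt 3 1 + eInt 4 2, eInt 2 1 + eInt 4 3, eInt 2 1 - eInt 4 3,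
    eInt 1 4 - eInt 3 2, eInt 1 4 + eInt 3 2, eInt 2 3 - eInt 4 1, eInt 2 3 + eInt 4 1,
    eInt 1 2 + eInt 3 4, eInt 1 2 - eInt 3 4]

/-- The degrees that make `Γ₆` a group grading. -/
def d₆ (k : Fin 15) : ZMod 2 × ZMod 4 × ZMod 2 :=
  (![0, 0, 0, 1, 1, 1, 1, 0, 0, 1, 1, 1, 1, 0, 0] k,
    ![0, 0, 2, 0, 0, 2, 2, 3, 3, 3, 1, 1, 3, 1, 1] k,
    ![0, 1, 1, 0, 1, 0, 1, 0, 1, 1, 0, 1, 0, 0, 1] k)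

theorem isIntegralDisplay₆ :
    IsIntegralDisplay b₆ id d₆ {0, 1, 9, 3, 4, 11} kInt₃ := by
  constructor <;> decide +kernel

theorem isHomogeneousBasis₆ : IsHomogeneousBasis Γ₆ (fun i => ofInt (b₆ i)) id :=
  isHomogeneousBasis_of_lines isIntegralDisplay₆.linearIndependent fun i => by
    fin_cases i <;> simp [Γ₆, b₆, ofInt_eInt]

theorem isComplexDisplay₆ : IsComplexDisplay Γ₆ S₆ K₃ :=
  isIntegralDisplay₆.isComplexDisplay isHomogeneousBasis₆
    (fun i => Or.inl (isHomogeneousBasis₆.isAtom fun _ h => h))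
    (isHomogeneousBasis₆.isUnsplittable_restrict fun _ _ _ h => h) (by simp [S₆]) K₃_eq_ofInt

/-- A basis of `sl(4, ℂ)` that is homogeneous for `Γ₇`. -/
def b₇ : Fin 15 → Matrix (Fin 4) (Fin 4) ℤ :=
  ![eInt 1 4 + eInt 2 3 + eInt 3 2 + eInt 4 1, eInt 1 4 - eInt 2 3 - eInt 3 2 + eInt 4 1,
    eInt 1 4 - eInt 2 3 + eInt 3 2 - eInt 4 1, eInt 1 4 + eInt 2 3 - eInt 3 2 - eInt 4 1,
    eInt 1 3 + eInt 2 4 + eInt 3 1 + eInt 4 2, eInt 1 3 - eInt 2 4 - eInt 3 1 + eInt 4 2,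
    eInt 1 3 - eInt 2 4 + eInt 3 1 - eInt 4 2, eInt 1 3 + eInt 2 4 - eInt 3 1 - eInt 4 2,
    eInt 1 2 + eInt 2 1 + eInt 3 4 + eInt 4 3, eInt 1 2 - eInt 2 1 - eInt 3 4 + eInt 4 3,
    eInt 1 2 - eInt 2 1 + eInt 3 4 - eInt 4 3, eInt 1 2 + eInt 2 1 - eInt 3 4 - eInt 4 3,
    eInt 1 1 - eInt 2 2 - eInt 3 3 + eInt 4 4, eInt 1 1 - eInt 2 2 + eInt 3 3 - eInt 4 4,
    eInt 1 1 + eInt 2 2 - eInt 3 3 - eInt 4 4]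

/-- The degrees that make `Γ₇` a group grading. -/
def d₇ (k : Fin 15) : ZMod 2 × ZMod 2 × ZMod 2 × ZMod 2 :=
  (![1, 1, 1, 1, 1, 1, 1, 1, 0, 0, 0, 0, 0, 0, 0] k,
    ![1, 1, 1, 1, 0, 0, 0, 0, 1, 1, 1, 1, 0, 0, 0] k,
    ![0, 1, 1, 0, 0, 1, 1, 0, 0, 1, 1, 0, 1, 1, 0] k,
    ![0, 1, 0, 1, 0, 1, 0, 1, 0, 1, 0, 1, 1, 0, 1] k)

theorem isIntegralDisplay₇ :
    IsIntegralDisplay b₇ id d₇ {2, 3, 7, 5, 10, 9} 1 := by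
  constructor <;> decide +kernel

theorem isHomogeneousBasis₇ : IsHomogeneousBasis Γ₇ (fun i => ofInt (b₇ i)) id :=
  isHomogeneousBasis_of_lines isIntegralDisplay₇.linearIndependent fun i => by
    fin_cases i <;> simp [Γ₇, b₇, ofInt_eInt]

theorem isComplexDisplay₇ : IsComplexDisplay Γ₇ S₇ K₁ :=
  isIntegralDisplay₇.isComplexDisplay isHomogeneousBasis₇
    (fun i => Or.inl (isHomogeneousBasis₇.isAtom fun _ h => h))
    (isHomogeneousBasis₇.isUnsplittable_restrict fun _ _ _ h => h) (by simp [S₇]) K₁_eq_ofInt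

/-- A basis of `sl(4, ℂ)` that is homogeneous for `Γ₈`. -/
def b₈ : Fin 15 → Matrix (Fin 4) (Fin 4) ℤ :=
  ![eInt 1 3 + eInt 2 4 + eInt 3 2 + eInt 4 1, eInt 1 3 - eInt 2 4 - eInt 3 2 + eInt 4 1,
    eInt 1 3 - eInt 2 4 + eInt 3 2 - eInt 4 1, eInt 1 3 + eInt 2 4 - eInt 3 2 - eInt 4 1,
    eInt 1 4 + eInt 2 3 + eInt 3 1 + eInt 4 2, eInt 1 4 - eInt 2 3 - eInt 3 1 + eInt 4 2,
    eInt 1 4 - eInt 2 3 + eInt 3 1 - eInt 4 2, eInt 1 4 + eInt 2 3 - eInt 3 1 - eInt 4 2,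
    eInt 1 1 + eInt 2 2 - eInt 3 3 - eInt 4 4, eInt 1 1 - eInt 2 2, eInt 3 3 - eInt 4 4,
    eInt 1 2 - eInt 2 1, eInt 3 4 - eInt 4 3, eInt 1 2 + eInt 2 1, eInt 3 4 + eInt 4 3]

/-- The degrees that make `Γ₈` a group grading. -/
def d₈ (k : Fin 14) : ZMod 4 × ZMod 2 × ZMod 2 :=
  (![3, 3, 3, 3, 1, 1, 1, 1, 0, 0, 0, 2, 2, 2] k,
    ![1, 1, 0, 0, 1, 0, 1, 0, 1, 1, 0, 0, 1, 1] k,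
    ![1, 0, 1, 0, 1, 1, 0, 0, 1, 0, 1, 1, 0, 1] k)

theorem isIntegralDisplay₈ :
    IsIntegralDisplay b₈ κ₁₄ d₈ {10, 3, 2, 11, 7, 5} kInt₂ := by
  constructor <;> decide +kernel

theorem isHomogeneousBasis₈ : IsHomogeneousBasis Γ₈ (fun i => ofInt (b₈ i)) κ₁₄ := by
  refine isHomogeneousBasis_of_lines_of_notMem isIntegralDisplay₈.linearIndependent (k₀ := 13)
    (J := {13, 14}) (by decide) (by decide) (by decide) (fun i hi => ?_) ?_
  · fin_cases i <;> first | exact absurd (by decide) hi | simp [Γ₈, κ₁₄, b₈, ofInt_eInt]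
  · simp [Γ₈, b₈, Set.image_insert_eq, ofInt_eInt]

theorem isWeightTable₈ :
    IsWeightTable b₈ κ₁₄ 13 ![13, 14] ![0, 1, 9, 10] ![7, 5, 11, 12]
      ![![1, -1], ![-1, -1], ![-2, 0], ![0, -2]] := by
  constructor <;> decide +kernel

theorem isUnsplittable₈ (k : Fin 14) : IsUnsplittable Γ₈ k := by
  refine isHomogeneousBasis₈.isUnsplittable (k₀ := 13) (by decide) ?_ k
  refine isWeightTable₈.ofInt.isUnsplittable isHomogeneousBasis₈ fun α β h => ?_
  have roots : (α 0 + -α 1 = 0 ∨ β 0 + -β 1 = 0) ∧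
      (-α 0 + -α 1 = 0 ∨ -β 0 + -β 1 = 0) ∧
      (α 0 = 0 ∨ β 0 = 0) ∧
      (α 1 = 0 ∨ β 1 = 0) := by
    simpa [Fin.forall_fin_succ, Fin.sum_univ_two] using h
  have : (α 0 = 0 ∧ α 1 = 0) ∨ (β 0 = 0 ∧ β 1 = 0) := by grind
  simpa [funext_iff, Fin.forall_fin_succ] using this

theorem isComplexDisplay₈ : IsComplexDisplay Γ₈ S₈ K₂ := by
  refine isIntegralDisplay₈.isComplexDisplay isHomogeneousBasis₈ isUnsplittable₈
    (isHomogeneousBasis₈.isUnsplittable_restrict ?_) (by simp [S₈]) K₂_eq_ofInt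
  simp only [S₈, Set.mem_insert_iff, Set.mem_singleton_iff]
  decide

end Concrete

/-! ### Real forms of `sl(4, ℂ)` -/

section RealForms

theorem IsHomogeneousBasis.isSpannedBy {ι n : Type} {Γ : ι → Submodule ℂ M4} {b : n → M4}
    {κ : n → ι} (h : IsHomogeneousBasis Γ b κ) {P : LieSubalgebra ℝ M4}
    (hb : ∀ i, ∃ c : ℂ, c ≠ 0 ∧ c • b i ∈ P) : IsSpannedBy Γ P := by
  refine fun k => le_antisymm (Submodule.span_le.2 fun x hx => hx.1) ?_
  rw [h.eq_span, Submodule.span_le]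
  rintro _ ⟨i, rfl, rfl⟩
  obtain ⟨c, hc, hcP⟩ := hb i
  have hmem : c • b i ∈ realPart Γ P (κ i) := ⟨Submodule.smul_mem _ c (h.mem i), hcP⟩
  exact (Submodule.smul_mem_iff _ hc).1 (Submodule.subset_span hmem)

theorem eq_zero_of_I_smul_eq_neg {V : Type} [AddCommGroup V] [Module ℂ V] {x : V}
    (h : Complex.I • x = -(Complex.I • x)) : x = 0 := by
  have h2 : (2 : ℂ) • Complex.I • x = 0 := by rw [two_smul, ← eq_neg_iff_add_eq_zero, ← h]
  exact (smul_eq_zero_iff_right Complex.I_ne_zero).1 ((smul_eq_zero_iff_right two_ne_zero).1 h2)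

theorem isTotallyReal_suStar {F : M4} (hF : IsUnit F) :
    IsTotallyReal (suStar F).toSubmodule := by
  rintro X ⟨-, hX⟩ ⟨-, hIX⟩
  have hconj : (Complex.I • X).map (starRingEnd ℂ) = -(Complex.I • X.map (starRingEnd ℂ)) := by
    ext i j
    simp
  rw [hconj, Matrix.mul_neg, Matrix.mul_smul, ← hX, Matrix.smul_mul] at hIX
  exact hF.mul_left_eq_zero.1 (eq_zero_of_I_smul_eq_neg hIX)

theorem isTotallyReal_su {E : M4} (hE : IsUnit E) : IsTotallyReal (su E).toSubmodule := by
  rintro X ⟨-, hX⟩ ⟨-, hIX⟩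
  have hconj : (Complex.I • X)ᴴ = -(Complex.I • Xᴴ) := by
    rw [conjTranspose_smul, Complex.star_def, Complex.conj_I, neg_smul]
  have hX' : E * Xᴴ = -(X * E) := by rw [hX, neg_neg]
  rw [hconj, Matrix.mul_neg, neg_neg, Matrix.mul_smul, hX', Matrix.smul_mul, smul_neg] at hIX
  exact hE.mul_left_eq_zero.1 (eq_zero_of_I_smul_eq_neg hIX)

end RealForms

section Signature

variable {n : Type} [Fintype n]

theorem eigenvalues_eq_one_or_neg_one [DecidableEq n] {E : Matrix n n ℂ} (hE : E.IsHermitian)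
    (hE2 : E * E = 1) (i : n) : hE.eigenvalues i = 1 ∨ hE.eigenvalues i = -1 := by
  have hvec := hE.mulVec_eigenvectorBasis i
  have hsq : (hE.eigenvalues i * hE.eigenvalues i) • ⇑(hE.eigenvectorBasis i) =
      (1 : ℝ) • ⇑(hE.eigenvectorBasis i) := by
    rw [← smul_smul, ← hvec, ← Matrix.mulVec_smul, ← hvec, Matrix.mulVec_mulVec, hE2,
      Matrix.one_mulVec, one_smul]
  have hne : (⇑(hE.eigenvectorBasis i) : n → ℂ) ≠ 0 := fun h =>
    hE.eigenvectorBasis.orthonormal.ne_zero i (by ext j; exact congrFun h j)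
  exact mul_self_eq_one_iff.1 (smul_left_injective ℝ hne hsq)

theorem card_pos_and_card_neg {v : n → ℝ} (hv : ∀ i, v i = 1 ∨ v i = -1) {p q : ℕ}
    (hpq : p + q = Fintype.card n) (hsum : ∑ i, v i = p - q) :
    Nat.card {i // 0 < v i} = p ∧ Nat.card {i // v i < 0} = q := by
  have hsub (i : n) : v i = (if 0 < v i then 1 else 0) - if v i < 0 then 1 else 0 := by
    rcases hv i with h | h <;> norm_num [h]
  have hadd (i : n) : (1 : ℕ) = (if 0 < v i then 1 else 0) + if v i < 0 then 1 else 0 := by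
    rcases hv i with h | h <;> norm_num [h]
  have hcard : Fintype.card n = ∑ _i : n, 1 := by
    rw [Finset.sum_const, smul_eq_mul, mul_one, Finset.card_univ]
  rw [Finset.sum_congr rfl fun i _ => hsub i, Finset.sum_sub_distrib, Finset.sum_boole,
    Finset.sum_boole, sub_eq_sub_iff_add_eq_add] at hsum
  rw [hcard, Finset.sum_congr rfl fun i _ => hadd i, Finset.sum_add_distrib, Finset.sum_boole,
    Finset.sum_boole] at hpq
  norm_cast at hsum hpq
  simp only [Nat.card_eq_fintype_card, Fintype.card_subtype]
  omega

theorem hasSignature_of_mul_self_eq_one {E : M4} (hE : E.IsHermitian) (hE2 : E * E = 1) {p q : ℕ}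
    (hpq : p + q = 4) (htr : E.trace = p - q) : HasSignature E p q := by
  have hsum : ∑ i, hE.eigenvalues i = (p : ℝ) - q := by
    apply Complex.ofReal_injective
    rw [Complex.ofReal_sum, Complex.ofReal_sub]
    exact hE.trace_eq_sum_eigenvalues.symm.trans htr
  exact ⟨hpq, hE, card_pos_and_card_neg (eigenvalues_eq_one_or_neg_one hE hE2)
    (hpq.trans (Fintype.card_fin 4).symm) hsum⟩

end Signature

/-! ### Isomorphisms with the standard real forms of `o(4, ℂ)` -/

section Conjugation

open LieAlgebra.Orthogonal (indefiniteDiagonal)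

variable {m n : Type} [Fintype m] [Fintype n]

theorem mul_eq_smul_mul_iff_conj [DecidableEq m] {S B : Matrix n m ℂ} {T A : Matrix m n ℂ}
    {K : Matrix m m ℂ} {I : Matrix n n ℂ} {c : ℂ} (hTS : T * S = 1) (hAB : A * B = 1) (hc : c ≠ 0)
    (hK : S * K * A = c • I) (r : ℂ) (X X' : Matrix m m ℂ) :
    X * K = r • (K * X') ↔ S * X * T * I = r • (I * (B * X' * A)) := by
  have hl : S * (X * K) * A = c • (S * X * T * I) := by
    rw [← Matrix.mul_smul, ← hK]
    simp only [← Matrix.mul_assoc, Matrix.mul_assoc _ T S, hTS, Matrix.mul_one]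
  have hr : S * (r • (K * X')) * A = c • (r • (I * (B * X' * A))) := by
    rw [smul_comm c r, ← Matrix.smul_mul c, ← hK, Matrix.mul_smul, Matrix.smul_mul]
    simp only [← Matrix.mul_assoc, Matrix.mul_assoc _ A B, hAB, Matrix.mul_one]
  have hcancel (Y : Matrix m m ℂ) : T * (S * Y * A) * B = Y := by
    simp only [← Matrix.mul_assoc, hTS, Matrix.one_mul, Matrix.mul_assoc _ A B, hAB, Matrix.mul_one]
  constructor
  · exact fun h => smul_right_injective _ hc (by simp only [← hl, ← hr, h])
  · intro h
    rw [← hcancel (X * K), hl, h, ← hr, hcancel]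

theorem mul_eq_neg_mul_transpose_iff_conj [DecidableEq m] {S : Matrix n m ℂ} {T : Matrix m n ℂ}
    {K : Matrix m m ℂ} {I : Matrix n n ℂ} {c : ℂ} (hTS : T * S = 1) (hc : c ≠ 0)
    (hK : S * K * Sᵀ = c • I) (X : Matrix m m ℂ) :
    X * K = -(K * Xᵀ) ↔ S * X * T * I = -(I * (S * X * T)ᵀ) := by
  have hST : Sᵀ * Tᵀ = 1 := by rw [← transpose_mul, hTS, transpose_one]
  simpa only [transpose_mul, Matrix.mul_assoc, neg_one_smul] using
    mul_eq_smul_mul_iff_conj hTS hST hc hK (-1) X Xᵀ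

theorem mul_eq_neg_mul_conjTranspose_iff_conj [DecidableEq m] {S : Matrix n m ℂ}
    {T : Matrix m n ℂ} {E : Matrix m m ℂ} {I : Matrix n n ℂ} {c : ℂ} (hTS : T * S = 1)
    (hc : c ≠ 0) (hE : S * E * Sᴴ = c • I) (X : Matrix m m ℂ) :
    X * E = -(E * Xᴴ) ↔ S * X * T * I = -(I * (S * X * T)ᴴ) := by
  have hST : Sᴴ * Tᴴ = 1 := by rw [← conjTranspose_mul, hTS, conjTranspose_one]
  simpa only [conjTranspose_mul, Matrix.mul_assoc, neg_one_smul] using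
    mul_eq_smul_mul_iff_conj hTS hST hc hE (-1) X Xᴴ

theorem mul_eq_mul_conj_iff_conj [DecidableEq m] [DecidableEq n] {S : Matrix n m ℂ}
    {T : Matrix m n ℂ} {F : Matrix m m ℂ} {J : Matrix n n ℂ} {c : ℂ} (hTS : T * S = 1)
    (hST : S * T = 1) (hc : c ≠ 0) (hF : S * F = c • (J * S.map (starRingEnd ℂ)))
    (X : Matrix m m ℂ) :
    X * F = F * X.map (starRingEnd ℂ) ↔
      S * X * T * J = J * (S * X * T).map (starRingEnd ℂ) := by
  have hTS' : T.map (starRingEnd ℂ) * S.map (starRingEnd ℂ) = 1 := by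
    rw [← Matrix.map_mul, hTS, Matrix.map_one _ (map_zero _) (map_one _)]
  have hST' : S.map (starRingEnd ℂ) * T.map (starRingEnd ℂ) = 1 := by
    rw [← Matrix.map_mul, hST, Matrix.map_one _ (map_zero _) (map_one _)]
  have hF' : S * F * T.map (starRingEnd ℂ) = c • J := by
    rw [hF, Matrix.smul_mul, Matrix.mul_assoc, hST', Matrix.mul_one]
  simpa only [Matrix.map_mul, one_smul] using
    mul_eq_smul_mul_iff_conj hTS hTS' hc hF' 1 X (X.map (starRingEnd ℂ))

theorem exists_inverse_of_mul_eq_smul [DecidableEq m] [DecidableEq n]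
    (hcard : Fintype.card n = Fintype.card m) {S : Matrix n m ℂ} {B : Matrix m n ℂ}
    {I : Matrix n n ℂ} {c : ℂ} (hI : I * I = 1) (hc : c ≠ 0) (h : S * B = c • I) :
    ∃ T : Matrix m n ℂ, S * T = 1 ∧ T * S = 1 := by
  have hST : S * (c⁻¹ • (B * I)) = 1 := by
    rw [Matrix.mul_smul, ← Matrix.mul_assoc, h, Matrix.smul_mul, hI, inv_smul_smul₀ hc]
  exact ⟨_, hST, (Matrix.mul_eq_one_comm_of_card_eq _ _ _ hcard).1 hST⟩

/-- Conjugation by a matrix `S` with the inverse `T`, as an isomorphism of real Lie algebras. -/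
def conjLieEquiv [DecidableEq m] [DecidableEq n] (S : Matrix n m ℂ) (T : Matrix m n ℂ)
    (hST : S * T = 1) (hTS : T * S = 1) : Matrix m m ℂ ≃ₗ⁅ℝ⁆ Matrix n n ℂ where
  toFun X := S * X * T
  invFun Y := T * Y * S
  map_add' X Y := by rw [Matrix.mul_add, Matrix.add_mul]
  map_smul' c X := by rw [Matrix.mul_smul, Matrix.smul_mul, RingHom.id_apply]
  map_lie' {X Y} := by
    have hmul (X Y : Matrix m m ℂ) : S * (X * Y) * T = S * X * T * (S * Y * T) := by
      simp only [← Matrix.mul_assoc, Matrix.mul_assoc _ T S, hTS, Matrix.mul_one]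
    simp only [Ring.lie_def, Matrix.mul_sub, Matrix.sub_mul, hmul]
  left_inv X := by
    simp only [← Matrix.mul_assoc, hTS, Matrix.one_mul, Matrix.mul_assoc _ T S, Matrix.mul_one]
  right_inv Y := by
    simp only [← Matrix.mul_assoc, hST, Matrix.one_mul, Matrix.mul_assoc _ S T, Matrix.mul_one]

theorem nonempty_lieEquiv_of_forall_mem_iff {L L' : Type} [LieRing L] [LieAlgebra ℝ L] [LieRing L']
    [LieAlgebra ℝ L'] (f : L ≃ₗ⁅ℝ⁆ L') {H : LieSubalgebra ℝ L} {H' : LieSubalgebra ℝ L'}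
    (h : ∀ x, x ∈ H ↔ f x ∈ H') : Nonempty (H ≃ₗ⁅ℝ⁆ H') := by
  refine ⟨f.ofSubalgebras _ _ (LieSubalgebra.ext _ _ fun y => ?_)⟩
  rw [LieSubalgebra.mem_map]
  exact ⟨fun ⟨x, hx, hxy⟩ => hxy ▸ (h x).1 hx,
    fun hy => ⟨f.symm y, (h _).2 ((f.apply_symm_apply y).symm ▸ hy), f.apply_symm_apply y⟩⟩

/-! ### The isomorphisms with `so(p, q)` -/

theorem indefiniteDiagonal_mul_self {p q R : Type} [Fintype p] [Fintype q] [DecidableEq p]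
    [DecidableEq q] [CommRing R] : indefiniteDiagonal p q R * indefiniteDiagonal p q R = 1 := by
  rw [indefiniteDiagonal, Matrix.diagonal_mul_diagonal, ← Matrix.diagonal_one]
  congr 1
  ext (i | i) <;> simp

theorem indefiniteDiagonal_map {p q R R' : Type} [DecidableEq p] [DecidableEq q] [CommRing R]
    [CommRing R'] (f : R →+* R') :
    (indefiniteDiagonal p q R).map f = indefiniteDiagonal p q R' := by
  rw [indefiniteDiagonal, Matrix.diagonal_map (map_zero f), indefiniteDiagonal]
  congr 1
  ext (i | i) <;> simp

theorem mul_eq_mul_swap {R : Type} [Monoid R] {a b d : R} (hd : d * d = 1)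
    (h : a * d = d * b) : b * d = d * a :=
  calc b * d = d * (d * b) * d := by rw [← mul_assoc, hd, one_mul]
    _ = d * a := by rw [← h, ← mul_assoc, mul_assoc, hd, mul_one]

theorem mem_soReal_iff {p q : ℕ} {Y : Matrix (Fin p ⊕ Fin q) (Fin p ⊕ Fin q) ℝ} :
    Y ∈ soReal p q ↔
      Y * indefiniteDiagonal (Fin p) (Fin q) ℝ = -(indefiniteDiagonal (Fin p) (Fin q) ℝ * Yᵀ) := by
  have h : Y ∈ soReal p q ↔
      Yᵀ * indefiniteDiagonal (Fin p) (Fin q) ℝ = indefiniteDiagonal (Fin p) (Fin q) ℝ * (-Y) :=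
    mem_skewAdjointMatricesSubmodule _ _
  rw [h, ← neg_eq_iff_eq_neg, ← neg_mul]
  exact ⟨mul_eq_mul_swap indefiniteDiagonal_mul_self, mul_eq_mul_swap indefiniteDiagonal_mul_self⟩

/-- The inclusion of the real matrices into the complex ones. -/
def ofRealLieHom (n : Type) [Fintype n] [DecidableEq n] : Matrix n n ℝ →ₗ⁅ℝ⁆ Matrix n n ℂ :=
  Complex.ofRealAm.mapMatrix.toLieHom

theorem ofRealLieHom_injective [DecidableEq n] : Function.Injective (ofRealLieHom n) :=
  Matrix.map_injective Complex.ofReal_injective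

theorem ofRealLieHom_mul [DecidableEq n] (X Y : Matrix n n ℝ) :
    ofRealLieHom n (X * Y) = ofRealLieHom n X * ofRealLieHom n Y :=
  map_mul Complex.ofRealAm.mapMatrix X Y

theorem ofRealLieHom_indefiniteDiagonal (p q : ℕ) :
    ofRealLieHom _ (indefiniteDiagonal (Fin p) (Fin q) ℝ) = indefiniteDiagonal (Fin p) (Fin q) ℂ :=
  indefiniteDiagonal_map Complex.ofRealHom

theorem mem_soReal_iff_ofRealLieHom {p q : ℕ} {Y : Matrix (Fin p ⊕ Fin q) (Fin p ⊕ Fin q) ℝ} :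
    Y ∈ soReal p q ↔
      ofRealLieHom _ Y * indefiniteDiagonal (Fin p) (Fin q) ℂ =
        -(indefiniteDiagonal (Fin p) (Fin q) ℂ * (ofRealLieHom _ Y)ᵀ) := by
  rw [mem_soReal_iff, ← ofRealLieHom_injective.eq_iff, map_neg, ofRealLieHom_mul,
    ofRealLieHom_mul, ofRealLieHom_indefiniteDiagonal]
  rfl

theorem conjTranspose_ofRealLieHom [DecidableEq n] (Y : Matrix n n ℝ) :
    (ofRealLieHom n Y)ᴴ = (ofRealLieHom n Y)ᵀ :=
  Matrix.ext fun i j => Complex.conj_ofReal (Y j i)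

theorem mem_range_ofRealLieHom_iff [DecidableEq n] {Z : Matrix n n ℂ} :
    Z ∈ (ofRealLieHom n).range ↔ Zᴴ = Zᵀ := by
  refine ⟨?_, fun h => ⟨Z.map Complex.re, Matrix.ext fun i j =>
    Complex.conj_eq_iff_re.1 (congrFun (congrFun h j) i)⟩⟩
  rintro ⟨Y, rfl⟩
  exact conjTranspose_ofRealLieHom Y

theorem mem_map_soReal_iff {p q : ℕ} {Z : Matrix (Fin p ⊕ Fin q) (Fin p ⊕ Fin q) ℂ} :
    Z ∈ (soReal p q).map (ofRealLieHom _) ↔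
      Z * indefiniteDiagonal (Fin p) (Fin q) ℂ = -(indefiniteDiagonal (Fin p) (Fin q) ℂ * Zᵀ) ∧
        Z * indefiniteDiagonal (Fin p) (Fin q) ℂ =
          -(indefiniteDiagonal (Fin p) (Fin q) ℂ * Zᴴ) := by
  constructor
  · rintro ⟨Y, hY, rfl⟩
    have hY' := mem_soReal_iff_ofRealLieHom.1 hY
    exact ⟨hY', (conjTranspose_ofRealLieHom Y).symm ▸ hY'⟩
  · rintro ⟨ht, hh⟩
    have hreal : Zᴴ = Zᵀ := by
      have h := congrArg (indefiniteDiagonal (Fin p) (Fin q) ℂ * ·) (neg_inj.1 (hh.symm.trans ht))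
      simpa only [← Matrix.mul_assoc, indefiniteDiagonal_mul_self, Matrix.one_mul] using h
    obtain ⟨Y, rfl⟩ := mem_range_ofRealLieHom_iff.2 hreal
    exact ⟨Y, mem_soReal_iff_ofRealLieHom.2 ht, rfl⟩

theorem nonempty_map_soReal_lieEquiv (p q : ℕ) :
    Nonempty ((soReal p q).map (ofRealLieHom _) ≃ₗ⁅ℝ⁆ soReal p q) := by
  have hinj : Function.Injective ((ofRealLieHom _).comp (soReal p q).incl) :=
    ofRealLieHom_injective.comp Subtype.val_injective
  have hrange : ((ofRealLieHom _).comp (soReal p q).incl).range =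
      (soReal p q).map (ofRealLieHom _) := by
    ext Z
    simp
  exact ⟨hrange ▸ (LieEquiv.ofInjective _ hinj).symm⟩

theorem mem_oInter_iff {K : M4} (hK : K * K = 1) {P : LieSubalgebra ℝ M4} {p : M4 → Prop}
    (hP : ∀ X, X ∈ P ↔ X.trace = 0 ∧ p X) {X : M4} :
    X ∈ oInter K P ↔ X * K = -(K * Xᵀ) ∧ p X := by
  refine ⟨fun h => ⟨h.1, ((hP X).1 h.2).2⟩, fun h => ⟨h.1, (hP X).2 ⟨?_, h.2⟩⟩⟩
  exact trace_eq_zero_of_mem_oAlg hK h.1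

theorem nonempty_lieEquiv_soReal {K E : M4} (hK : K * K = 1) {p q : ℕ} (hpq : p + q = 4)
    {S : Matrix (Fin p ⊕ Fin q) (Fin 4) ℂ} {c c' : ℂ} (hc : c ≠ 0) (hc' : c' ≠ 0)
    (hSK : S * K * Sᵀ = c • indefiniteDiagonal (Fin p) (Fin q) ℂ)
    (hSE : S * E * Sᴴ = c' • indefiniteDiagonal (Fin p) (Fin q) ℂ) :
    Nonempty (oInter K (su E) ≃ₗ⁅ℝ⁆ soReal p q) := by
  have hcard : Fintype.card (Fin p ⊕ Fin q) = Fintype.card (Fin 4) := by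
    simpa only [Fintype.card_sum, Fintype.card_fin] using hpq
  obtain ⟨T, hST, hTS⟩ := exists_inverse_of_mul_eq_smul hcard indefiniteDiagonal_mul_self hc
    ((Matrix.mul_assoc _ _ _).symm.trans hSK)
  have hmem (X : M4) : X ∈ oInter K (su E) ↔
      conjLieEquiv S T hST hTS X ∈ (soReal p q).map (ofRealLieHom _) := by
    rw [mem_oInter_iff hK fun _ => Iff.rfl, mem_map_soReal_iff,
      mul_eq_neg_mul_transpose_iff_conj hTS hc hSK,
      mul_eq_neg_mul_conjTranspose_iff_conj hTS hc' hSE]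
    rfl
  obtain ⟨f⟩ := nonempty_lieEquiv_of_forall_mem_iff _ hmem
  obtain ⟨g⟩ := nonempty_map_soReal_lieEquiv p q
  exact ⟨f.trans g⟩

/-! ### The isomorphisms with `so*(4)` -/

theorem J_map {l R R' : Type} [DecidableEq l] [CommRing R] [CommRing R'] (f : R →+* R') :
    (Matrix.J l R).map f = Matrix.J l R' := by
  rw [Matrix.J, Matrix.fromBlocks_map, Matrix.J, Matrix.map_zero _ (map_zero f),
    Matrix.map_one _ (map_zero f) (map_one f), Matrix.map_neg _ (map_neg f),
    Matrix.map_one _ (map_zero f) (map_one f)]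

theorem mem_soStar_iff {Z : Matrix (Fin 2 ⊕ Fin 2) (Fin 2 ⊕ Fin 2) ℂ} :
    Z ∈ soStar ↔
      Z * 1 = -(1 * Zᵀ) ∧ Z * Matrix.J (Fin 2) ℂ = Matrix.J (Fin 2) ℂ * Z.map (starRingEnd ℂ) := by
  rw [Matrix.mul_one, Matrix.one_mul, ← neg_eq_iff_eq_neg, eq_comm (a := -Z)]
  refine and_congr_right fun (hZ : Zᵀ = -Z) => ?_
  have hZh : Zᴴ = -Z.map (starRingEnd ℂ) := by
    rw [conjTranspose, hZ]
    exact Matrix.map_neg _ (map_neg (starRingEnd ℂ)) Z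
  have hinj : Function.Injective fun X : Matrix (Fin 2 ⊕ Fin 2) (Fin 2 ⊕ Fin 2) ℂ =>
      X.map (starRingEnd ℂ) :=
    Matrix.map_injective (starRingEnd ℂ).injective
  have hinv : (Z.map (starRingEnd ℂ)).map (starRingEnd ℂ) = Z :=
    Matrix.ext fun i j => Complex.conj_conj (Z i j)
  rw [hZh, neg_mul, neg_add_eq_zero, ← hinj.eq_iff]
  simp only [Matrix.map_mul, hinv, J_map]

theorem nonempty_lieEquiv_soStar {K F : M4} (hK : K * K = 1)
    {S : Matrix (Fin 2 ⊕ Fin 2) (Fin 4) ℂ} {c c' : ℂ} (hc : c ≠ 0) (hc' : c' ≠ 0)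
    (hSK : S * K * Sᵀ = c • (1 : Matrix (Fin 2 ⊕ Fin 2) (Fin 2 ⊕ Fin 2) ℂ))
    (hSF : S * F = c' • (Matrix.J (Fin 2) ℂ * S.map (starRingEnd ℂ))) :
    Nonempty (oInter K (suStar F) ≃ₗ⁅ℝ⁆ soStar) := by
  have hcard : Fintype.card (Fin 2 ⊕ Fin 2) = Fintype.card (Fin 4) := by
    simp only [Fintype.card_sum, Fintype.card_fin]
  have hSK' : S * (K * Sᵀ) = c • (1 : Matrix (Fin 2 ⊕ Fin 2) (Fin 2 ⊕ Fin 2) ℂ) :=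
    (Matrix.mul_assoc _ _ _).symm.trans hSK
  obtain ⟨T, hST, hTS⟩ := exists_inverse_of_mul_eq_smul hcard (Matrix.one_mul _) hc hSK'
  refine nonempty_lieEquiv_of_forall_mem_iff (conjLieEquiv S T hST hTS) fun X => ?_
  rw [mem_oInter_iff hK fun _ => Iff.rfl, mem_soStar_iff,
    mul_eq_neg_mul_transpose_iff_conj hTS hc hSK, mul_eq_mul_conj_iff_conj hTS hST hc' hSF]
  rfl

end Conjugation

/-! ### Matrices with Gaussian integral entries -/

section Gaussian

open LieAlgebra.Orthogonal (indefiniteDiagonal)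

/-- The imaginary unit as a Gaussian integer. -/
def gI : GaussianInt := ⟨0, 1⟩

/-- The complex matrix with the given Gaussian integral entries. -/
def ofGaussian {m n : Type} (X : Matrix m n GaussianInt) : Matrix m n ℂ :=
  X.map GaussianInt.toComplex

variable {l m n : Type}

theorem ofGaussian_mul [Fintype m] (X : Matrix l m GaussianInt) (Y : Matrix m n GaussianInt) :
    ofGaussian (X * Y) = ofGaussian X * ofGaussian Y :=
  Matrix.map_mul

theorem ofGaussian_one [DecidableEq m] : ofGaussian (1 : Matrix m m GaussianInt) = 1 :=
  Matrix.map_one _ (map_zero _) (map_one _)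

theorem ofGaussian_neg (X : Matrix m n GaussianInt) : ofGaussian (-X) = -ofGaussian X :=
  Matrix.map_neg _ (map_neg _) X

theorem ofGaussian_smul (c : GaussianInt) (X : Matrix m n GaussianInt) :
    ofGaussian (c • X) = (c : ℂ) • ofGaussian X :=
  Matrix.ext fun i j => map_mul GaussianInt.toComplex c (X i j)

theorem ofGaussian_transpose (X : Matrix m n GaussianInt) : ofGaussian Xᵀ = (ofGaussian X)ᵀ :=
  rfl

theorem ofGaussian_map_star (X : Matrix m n GaussianInt) :
    ofGaussian (X.map star) = (ofGaussian X).map (starRingEnd ℂ) :=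
  Matrix.ext fun i j => GaussianInt.toComplex_star (X i j)

theorem ofGaussian_conjTranspose (X : Matrix m n GaussianInt) :
    ofGaussian Xᴴ = (ofGaussian X)ᴴ :=
  Matrix.ext fun i j => GaussianInt.toComplex_star (X j i)

theorem trace_ofGaussian [Fintype m] (X : Matrix m m GaussianInt) :
    (ofGaussian X).trace = X.trace :=
  (AddMonoidHom.map_trace GaussianInt.toComplex X).symm

theorem ofGaussian_indefiniteDiagonal (p q : ℕ) :
    ofGaussian (indefiniteDiagonal (Fin p) (Fin q) GaussianInt) =
      indefiniteDiagonal (Fin p) (Fin q) ℂ :=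
  indefiniteDiagonal_map _

theorem ofGaussian_J : ofGaussian (Matrix.J (Fin 2) GaussianInt) = Matrix.J (Fin 2) ℂ :=
  J_map _

theorem ofGaussian_intCast (X : Matrix (Fin 4) (Fin 4) ℤ) :
    ofGaussian (X.map Int.cast) = ofInt X :=
  Matrix.ext fun i j => map_intCast GaussianInt.toComplex (X i j)

variable {K E F : M4} {K' E' F' : Matrix (Fin 4) (Fin 4) GaussianInt}

theorem isUnit_ofGaussian {G : Matrix (Fin 4) (Fin 4) GaussianInt}
    (h : E' * G = 1) : IsUnit (ofGaussian E') :=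
  IsUnit.of_mul_eq_one (ofGaussian G) (by rw [← ofGaussian_mul, h, ofGaussian_one])

theorem hasSignature_of_eq_ofGaussian (hE : E = ofGaussian E') (hherm : E'ᴴ = E')
    (hE2 : E' * E' = 1) {p q : ℕ} (hpq : p + q = 4) (htr : E'.trace = p - q) :
    HasSignature E p q := by
  subst hE
  refine hasSignature_of_mul_self_eq_one ?_ ?_ hpq ?_
  · exact (ofGaussian_conjTranspose E').symm.trans (congrArg ofGaussian hherm)
  · rw [← ofGaussian_mul, hE2, ofGaussian_one]
  · rw [trace_ofGaussian, htr, map_sub, map_natCast, map_natCast]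

theorem isAnticircular_of_eq_ofGaussian (hF : F = ofGaussian F') (h : F' * F'.map star = -1) :
    IsAnticircular F := by
  rw [IsAnticircular, hF, ← ofGaussian_map_star, ← ofGaussian_mul, h, ofGaussian_neg,
    ofGaussian_one]

theorem nonempty_lieEquiv_soReal_of_eq_ofGaussian (hK : K = ofGaussian K')
    (hE : E = ofGaussian E') (hK2 : K' * K' = 1) {p q : ℕ} (hpq : p + q = 4)
    {c : GaussianInt} (hc : c ≠ 0) (S : Matrix (Fin p ⊕ Fin q) (Fin 4) GaussianInt)
    (hSK : S * K' * Sᵀ = c • indefiniteDiagonal (Fin p) (Fin q) GaussianInt)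
    (hSE : S * E' * Sᴴ = c • indefiniteDiagonal (Fin p) (Fin q) GaussianInt) :
    Nonempty (oInter K (su E) ≃ₗ⁅ℝ⁆ soReal p q) := by
  subst hK hE
  have hc' : (c : ℂ) ≠ 0 := mt GaussianInt.toComplex_eq_zero.1 hc
  refine nonempty_lieEquiv_soReal (S := ofGaussian S) ?_ hpq hc' hc' ?_ ?_
  · rw [← ofGaussian_mul, hK2, ofGaussian_one]
  · rw [← ofGaussian_transpose, ← ofGaussian_mul, ← ofGaussian_mul, hSK, ofGaussian_smul,
      ofGaussian_indefiniteDiagonal]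
  · rw [← ofGaussian_conjTranspose, ← ofGaussian_mul, ← ofGaussian_mul, hSE, ofGaussian_smul,
      ofGaussian_indefiniteDiagonal]

theorem nonempty_lieEquiv_soStar_of_eq_ofGaussian (hK : K = ofGaussian K')
    (hF : F = ofGaussian F') (hK2 : K' * K' = 1) {c c' : GaussianInt} (hc : c ≠ 0) (hc' : c' ≠ 0)
    (S : Matrix (Fin 2 ⊕ Fin 2) (Fin 4) GaussianInt) (hSK : S * K' * Sᵀ = c • 1)
    (hSF : S * F' = c' • (Matrix.J (Fin 2) GaussianInt * S.map star)) :
    Nonempty (oInter K (suStar F) ≃ₗ⁅ℝ⁆ soStar) := by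
  subst hK hF
  refine nonempty_lieEquiv_soStar (S := ofGaussian S) ?_ (mt GaussianInt.toComplex_eq_zero.1 hc)
    (mt GaussianInt.toComplex_eq_zero.1 hc') ?_ ?_
  · rw [← ofGaussian_mul, hK2, ofGaussian_one]
  · rw [← ofGaussian_transpose, ← ofGaussian_mul, ← ofGaussian_mul, hSK, ofGaussian_smul,
      ofGaussian_one]
  · rw [← ofGaussian_map_star, ← ofGaussian_mul, hSF, ofGaussian_smul, ofGaussian_mul,
      ofGaussian_J]

/-- The scalars by which the integral basis vectors are multiplied to lie in a real form. Only the
square of such a scalar, up to a positive factor, matters: here the squares are `1`, `-1`, `2i` and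
`-2i`. -/
def phase : Fin 4 → GaussianInt := ![1, gI, 1 + gI, 1 - gI]

theorem phase_ne_zero (j : Fin 4) : (phase j : ℂ) ≠ 0 := by
  refine mt GaussianInt.toComplex_eq_zero.1 ?_
  revert j
  decide +kernel

section Display

variable {ι : Type} {Γ : ι → Submodule ℂ M4} {S : Set ι} {κ : Fin 15 → ι}
  {b : Fin 15 → Matrix (Fin 4) (Fin 4) ℤ} {R : Type} [LieRing R] [LieAlgebra ℝ R]

theorem trace_eq_zero_of_mem_grading (hΓ : IsGrading sl4 Γ) {k : ι} {X : M4} (hX : X ∈ Γ k) :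
    X.trace = 0 :=
  mem_sl_iff.1 (hΓ.iSup_eq ▸ le_iSup Γ k hX : X ∈ sl4.toSubmodule)

namespace IsComplexDisplay

theorem isSpannedBy_of_phase (h : IsComplexDisplay Γ S K)
    (hb : IsHomogeneousBasis Γ (fun i => ofInt (b i)) κ) {P : LieSubalgebra ℝ M4} {p : M4 → Prop}
    (hP : ∀ X, X ∈ P ↔ X.trace = 0 ∧ p X)
    (hbP : ∀ i, ∃ j, p (ofGaussian (phase j • (b i).map Int.cast))) : IsSpannedBy Γ P := by
  refine hb.isSpannedBy fun i => ?_
  obtain ⟨j, hj⟩ := hbP i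
  rw [ofGaussian_smul, ofGaussian_intCast] at hj
  exact ⟨phase j, phase_ne_zero j, (hP _).2 ⟨trace_eq_zero_of_mem_grading
    h.isAbelianGroupGrading.1 (Submodule.smul_mem _ _ (hb.mem i)), hj⟩⟩

theorem displays_su (h : IsComplexDisplay Γ S K)
    (hb : IsHomogeneousBasis Γ (fun i => ofInt (b i)) κ) (hE : E = ofGaussian E')
    (hE2 : E' * E' = 1)
    (hbE : ∀ i, ∃ j, (phase j • (b i).map Int.cast) * E' =
      -(E' * (phase j • (b i).map Int.cast)ᴴ))
    (hR : Nonempty (oInter K (su E) ≃ₗ⁅ℝ⁆ R)) : Displays Γ S K (su E) R := by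
  subst hE
  refine h.displays (isTotallyReal_su (isUnit_ofGaussian hE2)) (fun x hx => mem_sl_iff.2 hx.1)
    (h.isSpannedBy_of_phase hb (fun _ => Iff.rfl) fun i => (hbE i).imp fun j hj => ?_) hR
  rw [← ofGaussian_mul, hj, ofGaussian_neg, ofGaussian_mul, ofGaussian_conjTranspose]

theorem displays_suStar (h : IsComplexDisplay Γ S K)
    (hb : IsHomogeneousBasis Γ (fun i => ofInt (b i)) κ) (hF : F = ofGaussian F')
    (hF2 : F' * F'.map star = -1)
    (hbF : ∀ i, ∃ j, (phase j • (b i).map Int.cast) * F' =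
      F' * (phase j • (b i).map Int.cast).map star)
    (hR : Nonempty (oInter K (suStar F) ≃ₗ⁅ℝ⁆ R)) : Displays Γ S K (suStar F) R := by
  subst hF
  have hunit : IsUnit (ofGaussian F') :=
    isUnit_ofGaussian (G := -F'.map star) (by rw [Matrix.mul_neg, hF2, neg_neg])
  refine h.displays (isTotallyReal_suStar hunit) (fun x hx => mem_sl_iff.2 hx.1)
    (h.isSpannedBy_of_phase hb (fun _ => Iff.rfl) fun i => (hbF i).imp fun j hj => ?_) hR
  rw [← ofGaussian_mul, hj, ofGaussian_mul, ofGaussian_map_star]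

end IsComplexDisplay

end Display

end Gaussian

/-! ### The fourteen cases -/

section Cases

/-- The Gaussian integral matrix with the entries of `F₁`. -/
def gF₁ : Matrix (Fin 4) (Fin 4) GaussianInt :=
  !![0, 0, 1, 0; 0, 0, 0, 1; -1, 0, 0, 0; 0, -1, 0, 0]

/-- The Gaussian integral matrix with the entries of `F₂`. -/
def gF₂ : Matrix (Fin 4) (Fin 4) GaussianInt :=
  !![0, 1, 0, 0; -1, 0, 0, 0; 0, 0, 0, gI; 0, 0, -gI, 0]

/-- The Gaussian integral matrix with the entries of `K₂`. -/
def gK₂ : Matrix (Fin 4) (Fin 4) GaussianInt := kInt₂.map Int.cast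

/-- The Gaussian integral matrix with the entries of `K₃`. -/
def gK₃ : Matrix (Fin 4) (Fin 4) GaussianInt := kInt₃.map Int.cast

/-- The Gaussian integral matrix with the entries of `E31₁`. -/
def gE31₁ : Matrix (Fin 4) (Fin 4) GaussianInt :=
  !![1, 0, 0, 0; 0, 1, 0, 0; 0, 0, 1, 0; 0, 0, 0, -1]

/-- The Gaussian integral matrix with the entries of `E22₁`. -/
def gE22₁ : Matrix (Fin 4) (Fin 4) GaussianInt :=
  !![1, 0, 0, 0; 0, 1, 0, 0; 0, 0, -1, 0; 0, 0, 0, -1]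

/-- The Gaussian integral matrix with the entries of `E22₂`. -/
def gE22₂ : Matrix (Fin 4) (Fin 4) GaussianInt :=
  !![1, 0, 0, 0; 0, -1, 0, 0; 0, 0, 0, 1; 0, 0, 1, 0]

/-- The Gaussian integral matrix with the entries of `E22₅`. -/
def gE22₅ : Matrix (Fin 4) (Fin 4) GaussianInt :=
  !![1, 0, 0, 0; 0, -1, 0, 0; 0, 0, 0, gI; 0, 0, -gI, 0]

theorem K₁_eq_ofGaussian : K₁ = ofGaussian 1 := ofGaussian_one.symm

theorem K₂_eq_ofGaussian : K₂ = ofGaussian gK₂ :=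
  K₂_eq_ofInt.trans (ofGaussian_intCast kInt₂).symm

theorem K₃_eq_ofGaussian : K₃ = ofGaussian gK₃ :=
  K₃_eq_ofInt.trans (ofGaussian_intCast kInt₃).symm

theorem F₁_eq_ofGaussian : F₁ = ofGaussian gF₁ := by
  ext i j
  fin_cases i <;> fin_cases j <;> simp [ofGaussian, F₁, gF₁]

theorem F₂_eq_ofGaussian : F₂ = ofGaussian gF₂ := by
  ext i j
  fin_cases i <;> fin_cases j <;> simp [ofGaussian, F₂, gF₂, gI, GaussianInt.toComplex_def]

theorem E40₁_eq_ofGaussian : E40₁ = ofGaussian 1 := K₁_eq_ofGaussian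

theorem E31₁_eq_ofGaussian : E31₁ = ofGaussian gE31₁ := by
  ext i j
  fin_cases i <;> fin_cases j <;> simp [ofGaussian, E31₁, gE31₁]

theorem E31₂_eq_ofGaussian : E31₂ = ofGaussian gK₂ := K₂_eq_ofGaussian

theorem E22₁_eq_ofGaussian : E22₁ = ofGaussian gE22₁ := by
  ext i j
  fin_cases i <;> fin_cases j <;> simp [ofGaussian, E22₁, gE22₁]

theorem E22₂_eq_ofGaussian : E22₂ = ofGaussian gE22₂ := by
  ext i j
  fin_cases i <;> fin_cases j <;> simp [ofGaussian, E22₂, gE22₂]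

theorem E22₃_eq_ofGaussian : E22₃ = ofGaussian gK₃ := K₃_eq_ofGaussian

theorem E22₅_eq_ofGaussian : E22₅ = ofGaussian gE22₅ := by
  ext i j
  fin_cases i <;> fin_cases j <;>
    simp [ofGaussian, E22₅, gE22₅, gI, GaussianInt.toComplex_def]

theorem isAnticircular_F₁ : IsAnticircular F₁ :=
  isAnticircular_of_eq_ofGaussian F₁_eq_ofGaussian (by decide +kernel)

theorem isAnticircular_F₂ : IsAnticircular F₂ :=
  isAnticircular_of_eq_ofGaussian F₂_eq_ofGaussian (by decide +kernel)

theorem hasSignature_E40₁ : HasSignature E40₁ 4 0 :=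
  hasSignature_of_eq_ofGaussian E40₁_eq_ofGaussian (by decide +kernel) (by decide +kernel) rfl
    (by decide +kernel)

theorem hasSignature_E31₁ : HasSignature E31₁ 3 1 :=
  hasSignature_of_eq_ofGaussian E31₁_eq_ofGaussian (by decide +kernel) (by decide +kernel) rfl
    (by decide +kernel)

theorem hasSignature_E31₂ : HasSignature E31₂ 3 1 :=
  hasSignature_of_eq_ofGaussian E31₂_eq_ofGaussian (by decide +kernel) (by decide +kernel) rfl
    (by decide +kernel)

theorem hasSignature_E22₁ : HasSignature E22₁ 2 2 :=
  hasSignature_of_eq_ofGaussian E22₁_eq_ofGaussian (by decide +kernel) (by decide +kernel) rfl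
    (by decide +kernel)

theorem hasSignature_E22₂ : HasSignature E22₂ 2 2 :=
  hasSignature_of_eq_ofGaussian E22₂_eq_ofGaussian (by decide +kernel) (by decide +kernel) rfl
    (by decide +kernel)

theorem hasSignature_E22₃ : HasSignature E22₃ 2 2 :=
  hasSignature_of_eq_ofGaussian E22₃_eq_ofGaussian (by decide +kernel) (by decide +kernel) rfl
    (by decide +kernel)

theorem hasSignature_E22₅ : HasSignature E22₅ 2 2 :=
  hasSignature_of_eq_ofGaussian E22₅_eq_ofGaussian (by decide +kernel) (by decide +kernel) rfl
    (by decide +kernel)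

theorem nonempty_lieEquiv_oInter_K₁_su_E40₁ :
    Nonempty (oInter K₁ (su E40₁) ≃ₗ⁅ℝ⁆ soReal 4 0) :=
  nonempty_lieEquiv_soReal_of_eq_ofGaussian K₁_eq_ofGaussian E40₁_eq_ofGaussian
    (by decide +kernel) rfl (c := 1) (by decide +kernel)
    (fromRows 1 (of ![]))
    (by decide +kernel) (by decide +kernel)

theorem nonempty_lieEquiv_oInter_K₁_su_E31₁ :
    Nonempty (oInter K₁ (su E31₁) ≃ₗ⁅ℝ⁆ soReal 3 1) :=
  nonempty_lieEquiv_soReal_of_eq_ofGaussian K₁_eq_ofGaussian E31₁_eq_ofGaussian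
    (by decide +kernel) rfl (c := 1) (by decide +kernel)
    (fromRows !![1, 0, 0, 0; 0, 1, 0, 0; 0, 0, 1, 0] !![0, 0, 0, gI])
    (by decide +kernel) (by decide +kernel)

theorem nonempty_lieEquiv_oInter_K₂_su_E31₂ :
    Nonempty (oInter K₂ (su E31₂) ≃ₗ⁅ℝ⁆ soReal 3 1) :=
  nonempty_lieEquiv_soReal_of_eq_ofGaussian K₂_eq_ofGaussian E31₂_eq_ofGaussian
    (by decide +kernel) rfl (c := 2) (by decide +kernel)
    (fromRows !![1, 1, 0, 0; 1, -1, 0, 0; 0, 0, 1, 1] !![0, 0, 1, -1])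
    (by decide +kernel) (by decide +kernel)

theorem nonempty_lieEquiv_oInter_K₁_su_E22₁ :
    Nonempty (oInter K₁ (su E22₁) ≃ₗ⁅ℝ⁆ soReal 2 2) :=
  nonempty_lieEquiv_soReal_of_eq_ofGaussian K₁_eq_ofGaussian E22₁_eq_ofGaussian
    (by decide +kernel) rfl (c := 1) (by decide +kernel)
    (fromRows !![1, 0, 0, 0; 0, 1, 0, 0] !![0, 0, gI, 0; 0, 0, 0, gI])
    (by decide +kernel) (by decide +kernel)

theorem nonempty_lieEquiv_oInter_K₂_su_E22₂ :
    Nonempty (oInter K₂ (su E22₂) ≃ₗ⁅ℝ⁆ soReal 2 2) :=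
  nonempty_lieEquiv_soReal_of_eq_ofGaussian K₂_eq_ofGaussian E22₂_eq_ofGaussian
    (by decide +kernel) rfl (c := 4) (by decide +kernel)
    (fromRows !![2, 0, 0, 0; 0, 0, 2, 1] !![0, 2 * gI, 0, 0; 0, 0, 2, -1])
    (by decide +kernel) (by decide +kernel)

theorem nonempty_lieEquiv_oInter_K₃_su_E22₃ :
    Nonempty (oInter K₃ (su E22₃) ≃ₗ⁅ℝ⁆ soReal 2 2) :=
  nonempty_lieEquiv_soReal_of_eq_ofGaussian K₃_eq_ofGaussian E22₃_eq_ofGaussian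
    (by decide +kernel) rfl (c := 2) (by decide +kernel)
    (fromRows !![1, 1, 0, 0; 0, 0, 1, 1] !![1, -1, 0, 0; 0, 0, 1, -1])
    (by decide +kernel) (by decide +kernel)

theorem nonempty_lieEquiv_oInter_K₂_su_E22₅ :
    Nonempty (oInter K₂ (su E22₅) ≃ₗ⁅ℝ⁆ soReal 2 2) :=
  nonempty_lieEquiv_soReal_of_eq_ofGaussian K₂_eq_ofGaussian E22₅_eq_ofGaussian
    (by decide +kernel) rfl (c := 4) (by decide +kernel)
    (fromRows !![2, 0, 0, 0; 0, 0, 1 - gI, 1 + gI]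
      !![0, 2 * gI, 0, 0; 0, 0, 1 - gI, -1 - gI])
    (by decide +kernel) (by decide +kernel)

theorem nonempty_lieEquiv_oInter_K₃_suStar_F₁ :
    Nonempty (oInter K₃ (suStar F₁) ≃ₗ⁅ℝ⁆ soStar) :=
  nonempty_lieEquiv_soStar_of_eq_ofGaussian K₃_eq_ofGaussian F₁_eq_ofGaussian
    (by decide +kernel) (c := 2) (c' := -1) (by decide +kernel) (by decide +kernel)
    (fromRows !![1, 1, 0, 0; 0, 0, gI, -gI] !![0, 0, 1, 1; gI, -gI, 0, 0])
    (by decide +kernel) (by decide +kernel)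

theorem nonempty_lieEquiv_oInter_K₁_suStar_F₁ :
    Nonempty (oInter K₁ (suStar F₁) ≃ₗ⁅ℝ⁆ soStar) :=
  nonempty_lieEquiv_soStar_of_eq_ofGaussian K₁_eq_ofGaussian F₁_eq_ofGaussian
    (by decide +kernel) (c := 1) (c' := -1) (by decide +kernel) (by decide +kernel)
    (fromRows !![1, 0, 0, 0; 0, 1, 0, 0] !![0, 0, 1, 0; 0, 0, 0, 1])
    (by decide +kernel) (by decide +kernel)

theorem nonempty_lieEquiv_oInter_K₂_suStar_F₂ :
    Nonempty (oInter K₂ (suStar F₂) ≃ₗ⁅ℝ⁆ soStar) :=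
  nonempty_lieEquiv_soStar_of_eq_ofGaussian K₂_eq_ofGaussian F₂_eq_ofGaussian
    (by decide +kernel) (c := 2) (c' := 1) (by decide +kernel) (by decide +kernel)
    (fromRows !![1, 1, 0, 0; 0, 0, 1, 1] !![1, -1, 0, 0; 0, 0, -gI, gI])
    (by decide +kernel) (by decide +kernel)

theorem displays_Γ₆_suStar_F₁ : Displays Γ₆ S₆ K₃ (suStar F₁) soStar :=
  isComplexDisplay₆.displays_suStar isHomogeneousBasis₆ F₁_eq_ofGaussian (by decide +kernel)
    (by decide +kernel) nonempty_lieEquiv_oInter_K₃_suStar_F₁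

theorem displays_Γ₇_suStar_F₁ : Displays Γ₇ S₇ K₁ (suStar F₁) soStar :=
  isComplexDisplay₇.displays_suStar isHomogeneousBasis₇ F₁_eq_ofGaussian (by decide +kernel)
    (by decide +kernel) nonempty_lieEquiv_oInter_K₁_suStar_F₁

theorem displays_Γ₈_suStar_F₂ : Displays Γ₈ S₈ K₂ (suStar F₂) soStar :=
  isComplexDisplay₈.displays_suStar isHomogeneousBasis₈ F₂_eq_ofGaussian (by decide +kernel)
    (by decide +kernel) nonempty_lieEquiv_oInter_K₂_suStar_F₂

theorem displays_Γ₃_su_E40₁ : Displays Γ₃ S₃ K₁ (su E40₁) (soReal 4 0) :=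
  isComplexDisplay₃.displays_su isHomogeneousBasis₃ E40₁_eq_ofGaussian (by decide +kernel)
    (by decide +kernel) nonempty_lieEquiv_oInter_K₁_su_E40₁

theorem displays_Γ₇_su_E40₁ : Displays Γ₇ S₇ K₁ (su E40₁) (soReal 4 0) :=
  isComplexDisplay₇.displays_su isHomogeneousBasis₇ E40₁_eq_ofGaussian (by decide +kernel)
    (by decide +kernel) nonempty_lieEquiv_oInter_K₁_su_E40₁

theorem displays_Γ₃_su_E31₁ : Displays Γ₃ S₃ K₁ (su E31₁) (soReal 3 1) :=
  isComplexDisplay₃.displays_su isHomogeneousBasis₃ E31₁_eq_ofGaussian (by decide +kernel)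
    (by decide +kernel) nonempty_lieEquiv_oInter_K₁_su_E31₁

theorem displays_Γ₄_su_E31₂ : Displays Γ₄ S₄ K₂ (su E31₂) (soReal 3 1) :=
  isComplexDisplay₄.displays_su isHomogeneousBasis₄ E31₂_eq_ofGaussian (by decide +kernel)
    (by decide +kernel) nonempty_lieEquiv_oInter_K₂_su_E31₂

theorem displays_Γ₈_su_E31₂ : Displays Γ₈ S₈ K₂ (su E31₂) (soReal 3 1) :=
  isComplexDisplay₈.displays_su isHomogeneousBasis₈ E31₂_eq_ofGaussian (by decide +kernel)
    (by decide +kernel) nonempty_lieEquiv_oInter_K₂_su_E31₂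

theorem displays_Γ₃_su_E22₁ : Displays Γ₃ S₃ K₁ (su E22₁) (soReal 2 2) :=
  isComplexDisplay₃.displays_su isHomogeneousBasis₃ E22₁_eq_ofGaussian (by decide +kernel)
    (by decide +kernel) nonempty_lieEquiv_oInter_K₁_su_E22₁

theorem displays_Γ₄_su_E22₂ : Displays Γ₄ S₄ K₂ (su E22₂) (soReal 2 2) :=
  isComplexDisplay₄.displays_su isHomogeneousBasis₄ E22₂_eq_ofGaussian (by decide +kernel)
    (by decide +kernel) nonempty_lieEquiv_oInter_K₂_su_E22₂

theorem displays_Γ₅_su_E22₃ : Displays Γ₅ S₅ K₃ (su E22₃) (soReal 2 2) :=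
  isComplexDisplay₅.displays_su isHomogeneousBasis₅ E22₃_eq_ofGaussian (by decide +kernel)
    (by decide +kernel) nonempty_lieEquiv_oInter_K₃_su_E22₃

theorem displays_Γ₆_su_E22₃ : Displays Γ₆ S₆ K₃ (su E22₃) (soReal 2 2) :=
  isComplexDisplay₆.displays_su isHomogeneousBasis₆ E22₃_eq_ofGaussian (by decide +kernel)
    (by decide +kernel) nonempty_lieEquiv_oInter_K₃_su_E22₃

theorem displays_Γ₇_su_E22₁ : Displays Γ₇ S₇ K₁ (su E22₁) (soReal 2 2) :=
  isComplexDisplay₇.displays_su isHomogeneousBasis₇ E22₁_eq_ofGaussian (by decide +kernel)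
    (by decide +kernel) nonempty_lieEquiv_oInter_K₁_su_E22₁

theorem displays_Γ₈_su_E22₅ : Displays Γ₈ S₈ K₂ (su E22₅) (soReal 2 2) :=
  isComplexDisplay₈.displays_su isHomogeneousBasis₈ E22₅_eq_ofGaussian (by decide +kernel)
    (by decide +kernel) nonempty_lieEquiv_oInter_K₂_su_E22₅

end Cases

end FineGradings

end

open FineGradings in
theorem mainTheorem6 :
    -- the source real forms of `sl(4, ℂ)`: `su*(4)`, `su(4,0)`, `su(3,1)`, `su(2,2)`
    (IsAnticircular F₁ ∧ IsAnticircular F₂ ∧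
      HasSignature E40₁ 4 0 ∧
      HasSignature E31₁ 3 1 ∧ HasSignature E31₂ 3 1 ∧
      HasSignature E22₁ 2 2 ∧ HasSignature E22₂ 2 2 ∧ HasSignature E22₃ 2 2 ∧
      HasSignature E22₅ 2 2) ∧
    -- `so*(4)`
    (Displays Γ₆ S₆ K₃ (suStar F₁) soStar ∧
      Displays Γ₇ S₇ K₁ (suStar F₁) soStar ∧
      Displays Γ₈ S₈ K₂ (suStar F₂) soStar) ∧
    -- `so(4,0)`
    (Displays Γ₃ S₃ K₁ (su E40₁) (soReal 4 0) ∧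
      Displays Γ₇ S₇ K₁ (su E40₁) (soReal 4 0)) ∧
    -- `so(3,1)`
    (Displays Γ₃ S₃ K₁ (su E31₁) (soReal 3 1) ∧
      Displays Γ₄ S₄ K₂ (su E31₂) (soReal 3 1) ∧
      Displays Γ₈ S₈ K₂ (su E31₂) (soReal 3 1)) ∧
    -- `so(2,2)`
    (Displays Γ₃ S₃ K₁ (su E22₁) (soReal 2 2) ∧
      Displays Γ₄ S₄ K₂ (su E22₂) (soReal 2 2) ∧
      Displays Γ₅ S₅ K₃ (su E22₃) (soReal 2 2) ∧
      Displays Γ₆ S₆ K₃ (su E22₃) (soReal 2 2) ∧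
      Displays Γ₇ S₇ K₁ (su E22₁) (soReal 2 2) ∧
      Displays Γ₈ S₈ K₂ (su E22₅) (soReal 2 2)) := by
  exact ⟨⟨isAnticircular_F₁, isAnticircular_F₂, hasSignature_E40₁, hasSignature_E31₁,
      hasSignature_E31₂, hasSignature_E22₁, hasSignature_E22₂, hasSignature_E22₃,
      hasSignature_E22₅⟩,
    ⟨displays_Γ₆_suStar_F₁, displays_Γ₇_suStar_F₁, displays_Γ₈_suStar_F₂⟩,
    ⟨displays_Γ₃_su_E40₁, displays_Γ₇_su_E40₁⟩,
    ⟨displays_Γ₃_su_E31₁, displays_Γ₄_su_E31₂, displays_Γ₈_su_E31₂⟩,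
    ⟨displays_Γ₃_su_E22₁, displays_Γ₄_su_E22₂, displays_Γ₅_su_E22₃, displays_Γ₆_su_E22₃,
      displays_Γ₇_su_E22₁, displays_Γ₈_su_E22₅⟩⟩
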